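/- **Proposition 4.4.** Let $M$ be an $n$-dimensional $C^\infty$ manifold with two Finsler metric functions $L$ and $\overline L$ (smooth and positive on the slit tangent bundle, positively homogeneous of degree one, with positive definite fundamental tensor), related by a $\beta$-conformal change $$\overline L(x,y)=e^{\sigma(x)}L(x,y)+\beta(x,y),\qquad \beta(x,y)=b_i(x)y^i,$$ with $\sigma$ a smooth function and $\beta$ a smooth 1-form on $M$. Work in any chart, at points with $y\neq 0$, with $\partial_i=\partial/\partial x^i$, $\dot\partial_i=\partial/\partial y^i$; the index $0$ denotes contraction with $y$. For $L$ put $L_i=\dot\partial_iL$, $L_{ij}=\dot\partial_jL_i$, $L_{ijk}=\dot\partial_kL_{ij}$, $L^i=y^i/L$, $g_{ij}=\frac12\dot\partial_i\dot\partial_jL^2$, $(g^{ij})=(g_{ij})^{-1}$, $h_{ij}=LL_{ij}$, $C_{ijk}=\frac12\dot\partial_kg_{ij}$. Let $N^i_j$ and $\Gamma^i_{jk}$ be the coefficients of the canonical nonlinear connection and of the Cartan connection of $(M,L)$: with $\gamma^i_{jk}=\frac12g^{ir}(\partial_jg_{rk}+\partial_kg_{jr}-\partial_rg_{jk})$, $$N^i_j=\gamma^i_{jk}y^k-C^i_{jk}\gamma^k_{rs}y^ry^s,\quad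 \delta_k=\partial_k-N^r_k\dot\partial_r,\quad \Gamma^i_{jk}=\tfrac12g^{ir}(\delta_jg_{rk}+\delta_kg_{jr}-\delta_rg_{jk}).$$ The torsion tensors are $$C^i_{jk}=g^{il}C_{ljk},\qquad P^i_{jk}=\dot\partial_kN^i_j-\Gamma^i_{jk},\qquad R^i_{jk}=\delta_kN^i_j-\delta_jN^i_k,$$ the horizontal covariant derivatives are $X^i_{j|k}=\delta_kX^i_j+X^r_j\Gamma^i_{rk}-X^i_r\Gamma^r_{jk}$ and $b_{i|j}=\partial_jb_i-b_r\Gamma^r_{ij}$, and barred objects are the same objects for $\overline L$. Let $D^i_{jk}=\overline\Gamma^i_{jk}-\Gamma^i_{jk}$, $D^i_{0j}=y^rD^i_{rj}$, $B^i_{jk}=\dot\partial_kD^i_{0j}$ and $\mathfrak U_{j,k}(Q_{jk})=Q_{jk}-Q_{kj}$. Then (a) $\overline C^i_{jk}=C^i_{jk}+A^i_{jk}$; (b) $\overline P^i_{jk}=P^i_{jk}-D^i_{jk}+B^i_{jk}$; (c) $\overline R^i_{jk}=R^i_{jk}+\mathfrak U_{j,k}\bigl(D^i_{0j|k}-(B^i_{jr}+P^i_{jr})D^r_{0k}\bigr)$,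 where $A^i_{jk}$, $D^i_{0j}$ and $D^i_{jk}$ are given explicitly as follows. Raise indices with $g^{ij}$, and put $m_i=b_i-\frac{\beta}{L}L_i$, $m^2=m_im^i$, $\tau=e^\sigma\overline L/L$, $\sigma_i=\partial_i\sigma$, $\sigma_0=\sigma_iy^i$, $\sigma_\beta=\sigma_ib^i$, $E_{ij}=\frac12(b_{i|j}+b_{j|i})$, $F_{ij}=\frac12(b_{i|j}-b_{j|i})$, $F^r_0=g^{ri}F_{i0}$, $F_{\beta0}=F_{i0}b^i$. Then $$A^i_{jk}=\frac1{2\overline L}\bigl(h_{jk}m^i+h^i_jm_k+h^i_km_j\bigr)-\frac{e^\sigma}{\tau}C_{jks}L^ib^s-\frac{e^\sigma}{2\overline L\tau}\bigl(2m_jm_k+m^2h_{jk}\bigr)L^i,$$ $$D^i_{0j}=Lg^{ir}G_{rj}+\frac L{\overline L}\bigl(G_j-Lb^qG_{qj}\bigr)L^i,\qquad D^i_{jk}=Lg^{ir}H_{rjk}+\frac L{\overline L}\bigl(H_{jk}-Lb^qH_{qjk}\bigr)L^i,$$ where, with $$D^r_{00}=2Le^{-\sigma}F^r_0+\frac L{\overline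 L}\bigl(E_{00}-2Le^{-\sigma}F_{\beta0}\bigr)L^r-L^2\sigma^r+\frac L{\overline L}\bigl(2Le^\sigma\sigma_0+L^2\sigma_\beta\bigr)L^r$$ and with the above $D^r_{0j}$ in the definitions of $H$, $$G_{ij}=e^{-\sigma}F_{ij}-\tfrac12L_{ijr}D^r_{00}+\tfrac12\bigl(\sigma_0L_{ij}-\sigma_iL_j+\sigma_jL_i\bigr),$$ $$G_i=E_{0i}-\tfrac12e^\sigma L_{ir}D^r_{00}+\tfrac12e^\sigma(\sigma_0L_i+\sigma_iL),$$ $$H_{ijk}=\tfrac12\bigl(L_{jkr}D^r_{0i}-L_{ijr}D^r_{0k}-L_{ikr}D^r_{0j}+\sigma_jL_{ik}+\sigma_kL_{ij}-\sigma_iL_{jk}\bigr),$$ $$H_{ij}=E_{ij}-\tfrac12e^\sigma\bigl(L_{ir}D^r_{0j}+L_{jr}D^r_{0i}-\sigma_iL_j-\sigma_jL_i\bigr).$$ -/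

import Mathlib

open scoped ContDiff Manifold

noncomputable section

namespace Finsler

/-- Coordinate space `ℝⁿ`. -/
abbrev Coord (n : ℕ) : Type := EuclideanSpace ℝ (Fin n)

/-- A scalar function of a position `x` and a supporting element `y`, in coordinates. -/
abbrev Fld (n : ℕ) : Type := Coord n → Coord n → ℝ

section Coordinates

/-! ### Differential operators in the coordinates `(x, y)` -/

/-- `∂_i`: partial differentiation with respect to `xⁱ`. -/
def dX {n : ℕ} (i : Fin n) (f : Fld n) : Fld n :=
  fun x y => fderiv ℝ (fun x' => f x' y) x (EuclideanSpace.single i 1)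

/-- `∂̇_i`: partial differentiation with respect to `yⁱ`. -/
def dY {n : ℕ} (i : Fin n) (f : Fld n) : Fld n :=
  fun x y => fderiv ℝ (fun y' => f x y') y (EuclideanSpace.single i 1)

/-! ### Objects attached to one Finsler function `L`, given in coordinates -/

/-- `L_i = ∂̇_i L`. -/
def L1 {n : ℕ} (L : Fld n) (i : Fin n) : Fld n := dY i L

/-- `L_{ij} = ∂̇_j L_i`. -/
def L2 {n : ℕ} (L : Fld n) (i j : Fin n) : Fld n := dY j (L1 L i)

/-- `L_{ijk} = ∂̇_k L_{ij}`. -/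
def L3 {n : ℕ} (L : Fld n) (i j k : Fin n) : Fld n := dY k (L2 L i j)

/-- `Lⁱ = yⁱ / L`. -/
def Lup {n : ℕ} (L : Fld n) (i : Fin n) : Fld n := fun x y => y i / L x y

/-- The fundamental metric tensor `g_{ij} = ½ ∂̇_i ∂̇_j L²`. -/
def g {n : ℕ} (L : Fld n) (i j : Fin n) : Fld n :=
  fun x y => 1 / 2 * dY i (dY j (fun x' y' => L x' y' ^ 2)) x y

/-- The matrix `(g_{ij}(x, y))`. -/
def gMatrix {n : ℕ} (L : Fld n) (x y : Coord n) : Matrix (Fin n) (Fin n) ℝ :=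
  Matrix.of fun i j => g L i j x y

/-- `g^{ij}`: the entries of the inverse matrix of `(g_{ij})`. -/
def gInv {n : ℕ} (L : Fld n) (i j : Fin n) : Fld n :=
  fun x y => (gMatrix L x y)⁻¹ i j

/-- The angular metric tensor `h_{ij} = L L_{ij}`. -/
def h {n : ℕ} (L : Fld n) (i j : Fin n) : Fld n := fun x y => L x y * L2 L i j x y

/-- `C_{ijk} = ½ ∂̇_k g_{ij}`. -/
def Clow {n : ℕ} (L : Fld n) (i j k : Fin n) : Fld n :=
  fun x y => 1 / 2 * dY k (g L i j) x y

/-- The (h)hv-torsion tensor `Cⁱ_{jk} = g^{il} C_{ljk}`. -/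
def C {n : ℕ} (L : Fld n) (i j k : Fin n) : Fld n :=
  fun x y => ∑ l, gInv L i l x y * Clow L l j k x y

/-- The formal Christoffel symbols
`γⁱ_{jk} = ½ g^{ir} (∂_j g_{rk} + ∂_k g_{jr} - ∂_r g_{jk})`. -/
def formalChristoffel {n : ℕ} (L : Fld n) (i j k : Fin n) : Fld n :=
  fun x y => 1 / 2 * ∑ r, gInv L i r x y *
    (dX j (g L r k) x y + dX k (g L j r) x y - dX r (g L j k) x y)

/-- The coefficients of the canonical (Cartan) nonlinear connection,
`Nⁱ_j = γⁱ_{jk} yᵏ - Cⁱ_{jk} γᵏ_{rs} yʳ yˢ`. (They agree with `yᵏ Γⁱ_{jk}`, where `Γ` are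
the Cartan connection coefficients below.) -/
def N {n : ℕ} (L : Fld n) (i j : Fin n) : Fld n :=
  fun x y => ∑ k, formalChristoffel L i j k x y * y k -
    ∑ k, C L i j k x y * ∑ r, ∑ s, formalChristoffel L k r s x y * y r * y s

/-- `δ_k = ∂_k - Nʳ_k ∂̇_r`. -/
def delta {n : ℕ} (L : Fld n) (k : Fin n) (f : Fld n) : Fld n :=
  fun x y => dX k f x y - ∑ r, N L r k x y * dY r f x y

/-- The (horizontal) coefficients of the Cartan connection,
`Γⁱ_{jk} = ½ g^{ir} (δ_j g_{rk} + δ_k g_{jr} - δ_r g_{jk})`. -/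
def Γ {n : ℕ} (L : Fld n) (i j k : Fin n) : Fld n :=
  fun x y => 1 / 2 * ∑ r, gInv L i r x y *
    (delta L j (g L r k) x y + delta L k (g L j r) x y - delta L r (g L j k) x y)

/-- The (v)hv-torsion tensor `Pⁱ_{jk} = ∂̇_k Nⁱ_j - Γⁱ_{jk}`. -/
def P {n : ℕ} (L : Fld n) (i j k : Fin n) : Fld n :=
  fun x y => dY k (N L i j) x y - Γ L i j k x y

/-- The (v)h-torsion tensor `Rⁱ_{jk} = δ_k Nⁱ_j - δ_j Nⁱ_k`. -/
def R {n : ℕ} (L : Fld n) (i j k : Fin n) : Fld n :=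
  fun x y => delta L k (N L i j) x y - delta L j (N L i k) x y

/-- The horizontal covariant derivative
`Xⁱ_{j|k} = δ_k Xⁱ_j + Xʳ_j Γⁱ_{rk} - Xⁱ_r Γʳ_{jk}`. -/
def hCov {n : ℕ} (L : Fld n) (X : Fin n → Fin n → Fld n) (i j k : Fin n) : Fld n :=
  fun x y => delta L k (X i j) x y + ∑ r, X r j x y * Γ L i r k x y -
    ∑ r, X i r x y * Γ L r j k x y

/-! ### Comparison of two Finsler functions -/

/-- The difference tensor `Dⁱ_{jk} = Γ̄ⁱ_{jk} - Γⁱ_{jk}`. -/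
def D {n : ℕ} (L L' : Fld n) (i j k : Fin n) : Fld n :=
  fun x y => Γ L' i j k x y - Γ L i j k x y

/-- `Dⁱ_{0j} = yʳ Dⁱ_{rj}`. -/
def D0 {n : ℕ} (L L' : Fld n) (i j : Fin n) : Fld n :=
  fun x y => ∑ r, y r * D L L' i r j x y

/-- `Bⁱ_{jk} = ∂̇_k Dⁱ_{0j}`. -/
def B {n : ℕ} (L L' : Fld n) (i j k : Fin n) : Fld n := dY k (D0 L L' i j)

/-! ### Explicit expressions in terms of `L`, of `σ`, and of the components `b_i` of `β`

Throughout, `s` is `σ` in coordinates and `b i` is `b_i`. Indices are raised with `g^{ij}`. -/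

/-- `L̄ = e^σ L + b_i yⁱ`. -/
def Lbar {n : ℕ} (L : Fld n) (s : Coord n → ℝ) (b : Fin n → Coord n → ℝ) : Fld n :=
  fun x y => Real.exp (s x) * L x y + ∑ i, b i x * y i

/-- `bⁱ = g^{ij} b_j`. -/
def bUp {n : ℕ} (L : Fld n) (b : Fin n → Coord n → ℝ) (i : Fin n) : Fld n :=
  fun x y => ∑ j, gInv L i j x y * b j x

/-- `m_i = b_i - (β / L) L_i`. -/
def m {n : ℕ} (L : Fld n) (b : Fin n → Coord n → ℝ) (i : Fin n) : Fld n :=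
  fun x y => b i x - (∑ j, b j x * y j) / L x y * L1 L i x y

/-- `mⁱ = g^{ik} m_k`. -/
def mUp {n : ℕ} (L : Fld n) (b : Fin n → Coord n → ℝ) (i : Fin n) : Fld n :=
  fun x y => ∑ k, gInv L i k x y * m L b k x y

/-- `m² = m_i mⁱ`. -/
def mSq {n : ℕ} (L : Fld n) (b : Fin n → Coord n → ℝ) : Fld n :=
  fun x y => ∑ i, m L b i x y * mUp L b i x y

/-- `hⁱ_j = g^{ik} h_{kj}`. -/
def hUp {n : ℕ} (L : Fld n) (i j : Fin n) : Fld n :=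
  fun x y => ∑ k, gInv L i k x y * h L k j x y

/-- `τ = e^σ L̄ / L`. -/
def τ {n : ℕ} (L : Fld n) (s : Coord n → ℝ) (b : Fin n → Coord n → ℝ) : Fld n :=
  fun x y => Real.exp (s x) * Lbar L s b x y / L x y

/-- `Aⁱ_{jk} = (1/2L̄) (h_{jk} mⁱ + hⁱ_j m_k + hⁱ_k m_j) - (e^σ/τ) C_{jks} Lⁱ bˢ
  - (e^σ/2L̄τ) (2 m_j m_k + m² h_{jk}) Lⁱ`. -/
def A {n : ℕ} (L : Fld n) (s : Coord n → ℝ) (b : Fin n → Coord n → ℝ)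
    (i j k : Fin n) : Fld n :=
  fun x y =>
    1 / (2 * Lbar L s b x y) *
        (h L j k x y * mUp L b i x y + hUp L i j x y * m L b k x y
          + hUp L i k x y * m L b j x y)
      - Real.exp (s x) / τ L s b x y *
          (∑ q, Clow L j k q x y * bUp L b q x y) * Lup L i x y
      - Real.exp (s x) / (2 * Lbar L s b x y * τ L s b x y) *
          (2 * m L b j x y * m L b k x y + mSq L b x y * h L j k x y) * Lup L i x y

/-- `σ_i = ∂σ/∂xⁱ`. -/
def sd {n : ℕ} (s : Coord n → ℝ) (i : Fin n) (x : Coord n) : ℝ :=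
  fderiv ℝ s x (EuclideanSpace.single i 1)

/-- `σ_0 = σ_i yⁱ`. -/
def sd0 {n : ℕ} (s : Coord n → ℝ) : Fld n := fun x y => ∑ i, sd s i x * y i

/-- `σⁱ = g^{ij} σ_j`. -/
def sUp {n : ℕ} (L : Fld n) (s : Coord n → ℝ) (i : Fin n) : Fld n :=
  fun x y => ∑ j, gInv L i j x y * sd s j x

/-- `σ_β = σ_i bⁱ`. -/
def sβ {n : ℕ} (L : Fld n) (s : Coord n → ℝ) (b : Fin n → Coord n → ℝ) : Fld n :=
  fun x y => ∑ i, sd s i x * bUp L b i x y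

/-- `b_{i|j} = ∂_j b_i - b_r Γʳ_{ij}`. -/
def bCov {n : ℕ} (L : Fld n) (b : Fin n → Coord n → ℝ) (i j : Fin n) : Fld n :=
  fun x y => fderiv ℝ (b i) x (EuclideanSpace.single j 1) - ∑ r, b r x * Γ L r i j x y

/-- `E_{ij} = ½ (b_{i|j} + b_{j|i})`. -/
def E {n : ℕ} (L : Fld n) (b : Fin n → Coord n → ℝ) (i j : Fin n) : Fld n :=
  fun x y => 1 / 2 * (bCov L b i j x y + bCov L b j i x y)

/-- `F_{ij} = ½ (b_{i|j} - b_{j|i})`. -/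
def F {n : ℕ} (L : Fld n) (b : Fin n → Coord n → ℝ) (i j : Fin n) : Fld n :=
  fun x y => 1 / 2 * (bCov L b i j x y - bCov L b j i x y)

/-- `E_{0i} = E_{ji} yʲ`. -/
def E0 {n : ℕ} (L : Fld n) (b : Fin n → Coord n → ℝ) (i : Fin n) : Fld n :=
  fun x y => ∑ j, E L b j i x y * y j

/-- `E_{00} = E_{ij} yⁱ yʲ`. -/
def E00 {n : ℕ} (L : Fld n) (b : Fin n → Coord n → ℝ) : Fld n :=
  fun x y => ∑ i, E0 L b i x y * y i

/-- `F_{i0} = F_{ij} yʲ`. -/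
def F0 {n : ℕ} (L : Fld n) (b : Fin n → Coord n → ℝ) (i : Fin n) : Fld n :=
  fun x y => ∑ j, F L b i j x y * y j

/-- `Fʳ_0 = g^{ir} F_{i0}`. -/
def F0Up {n : ℕ} (L : Fld n) (b : Fin n → Coord n → ℝ) (r : Fin n) : Fld n :=
  fun x y => ∑ i, gInv L i r x y * F0 L b i x y

/-- `F_{β0} = F_{i0} bⁱ`. -/
def Fβ0 {n : ℕ} (L : Fld n) (b : Fin n → Coord n → ℝ) : Fld n :=
  fun x y => ∑ i, F0 L b i x y * bUp L b i x y

/-- The explicit expression for `Dʳ_{00}`: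
`2L e^{-σ} Fʳ_0 + (L/L̄) (E_{00} - 2L e^{-σ} F_{β0}) Lʳ - L² σʳ
  + (L/L̄) (2L e^σ σ_0 + L² σ_β) Lʳ`. -/
def D00Expl {n : ℕ} (L : Fld n) (s : Coord n → ℝ) (b : Fin n → Coord n → ℝ)
    (r : Fin n) : Fld n :=
  fun x y =>
    2 * L x y * Real.exp (-s x) * F0Up L b r x y
      + L x y / Lbar L s b x y *
          (E00 L b x y - 2 * L x y * Real.exp (-s x) * Fβ0 L b x y) * Lup L r x y
      - L x y ^ 2 * sUp L s r x y
      + L x y / Lbar L s b x y *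
          (2 * L x y * Real.exp (s x) * sd0 s x y + L x y ^ 2 * sβ L s b x y) * Lup L r x y

/-- `G_{ij} = e^{-σ} F_{ij} - ½ L_{ijr} Dʳ_{00} + ½ (σ_0 L_{ij} - (σ_i L_j - σ_j L_i))`. -/
def G2 {n : ℕ} (L : Fld n) (s : Coord n → ℝ) (b : Fin n → Coord n → ℝ)
    (i j : Fin n) : Fld n :=
  fun x y =>
    Real.exp (-s x) * F L b i j x y - 1 / 2 * ∑ r, L3 L i j r x y * D00Expl L s b r x y
      + 1 / 2 * (sd0 s x y * L2 L i j x y - (sd s i x * L1 L j x y - sd s j x * L1 L i x y))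

/-- `G_i = E_{0i} - ½ e^σ L_{ir} Dʳ_{00} + ½ e^σ (σ_0 L_i + σ_i L)`. -/
def G1 {n : ℕ} (L : Fld n) (s : Coord n → ℝ) (b : Fin n → Coord n → ℝ) (i : Fin n) : Fld n :=
  fun x y =>
    E0 L b i x y - 1 / 2 * Real.exp (s x) * ∑ r, L2 L i r x y * D00Expl L s b r x y
      + 1 / 2 * Real.exp (s x) * (sd0 s x y * L1 L i x y + sd s i x * L x y)

/-- The explicit expression for `Dⁱ_{0j}`: `L Gⁱ_j + (L/L̄) (G_j - L G_{βj}) Lⁱ`, where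
`Gⁱ_j = g^{ir} G_{rj}` and `G_{βj} = bⁱ G_{ij}`. -/
def D0Expl {n : ℕ} (L : Fld n) (s : Coord n → ℝ) (b : Fin n → Coord n → ℝ)
    (i j : Fin n) : Fld n :=
  fun x y =>
    L x y * ∑ r, gInv L i r x y * G2 L s b r j x y
      + L x y / Lbar L s b x y *
          (G1 L s b j x y - L x y * ∑ q, bUp L b q x y * G2 L s b q j x y) * Lup L i x y

/-- `H_{ijk} = ½ (L_{jkr} Dʳ_{0i} - L_{ijr} Dʳ_{0k} - L_{ikr} Dʳ_{0j}
  + σ_j L_{ik} + σ_k L_{ij} - σ_i L_{jk})`. -/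
def H3 {n : ℕ} (L : Fld n) (s : Coord n → ℝ) (b : Fin n → Coord n → ℝ)
    (i j k : Fin n) : Fld n :=
  fun x y =>
    1 / 2 * (∑ r, L3 L j k r x y * D0Expl L s b r i x y
      - ∑ r, L3 L i j r x y * D0Expl L s b r k x y
      - ∑ r, L3 L i k r x y * D0Expl L s b r j x y
      + sd s j x * L2 L i k x y + sd s k x * L2 L i j x y - sd s i x * L2 L j k x y)

/-- `H_{ij} = E_{ij} - ½ e^σ (L_{ir} Dʳ_{0j} + L_{jr} Dʳ_{0i} - (σ_i L_j + σ_j L_i))`. -/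
def H2 {n : ℕ} (L : Fld n) (s : Coord n → ℝ) (b : Fin n → Coord n → ℝ)
    (i j : Fin n) : Fld n :=
  fun x y =>
    E L b i j x y - 1 / 2 * Real.exp (s x) *
      (∑ r, L2 L i r x y * D0Expl L s b r j x y + ∑ r, L2 L j r x y * D0Expl L s b r i x y
        - (sd s i x * L1 L j x y + sd s j x * L1 L i x y))

/-- The explicit expression for `Dⁱ_{jk}`: `L Hⁱ_{jk} + (L/L̄) (H_{jk} - L H_{βjk}) Lⁱ`, where
`Hⁱ_{jk} = g^{ir} H_{rjk}` and `H_{βjk} = bⁱ H_{ijk}`. -/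
def DExpl {n : ℕ} (L : Fld n) (s : Coord n → ℝ) (b : Fin n → Coord n → ℝ)
    (i j k : Fin n) : Fld n :=
  fun x y =>
    L x y * ∑ r, gInv L i r x y * H3 L s b r j k x y
      + L x y / Lbar L s b x y *
          (H2 L s b j k x y - L x y * ∑ q, bUp L b q x y * H3 L s b q j k x y) * Lup L i x y

end Coordinates

section Manifold

/-- The function `L` on `TM` in the coordinates `(x, y)` of `TM` induced by the chart `φ`: the
point with these coordinates is the tangent vector `yⁱ ∂/∂xⁱ` at `φ⁻¹(x)`. -/
def coordFun {n : ℕ} {M : Type*} [TopologicalSpace M] [ChartedSpace (Coord n) M]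
    (φ : OpenPartialHomeomorph M (Coord n)) (L : TangentBundle (𝓡 n) M → ℝ) : Fld n :=
  fun x y => L ⟨φ.symm x, mfderiv (𝓡 n) (𝓡 n) φ.symm x y⟩

/-- The components `b_i = β(∂/∂xⁱ)` of the 1-form `β` in the chart `φ`. -/
def coordForm {n : ℕ} {M : Type*} [TopologicalSpace M] [ChartedSpace (Coord n) M]
    (φ : OpenPartialHomeomorph M (Coord n)) (β : ∀ p : M, TangentSpace (𝓡 n) p →L[ℝ] ℝ)
    (i : Fin n) : Coord n → ℝ :=
  fun x => β (φ.symm x) (mfderiv (𝓡 n) (𝓡 n) φ.symm x (EuclideanSpace.single i (1 : ℝ)))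

/-- A 1-form is smooth if its components are smooth in every chart. -/
def IsSmoothForm {n : ℕ} {M : Type*} [TopologicalSpace M] [ChartedSpace (Coord n) M]
    (β : ∀ p : M, TangentSpace (𝓡 n) p →L[ℝ] ℝ) : Prop :=
  ∀ φ ∈ IsManifold.maximalAtlas (𝓡 n) ∞ M, ∀ i : Fin n,
    ContDiffOn ℝ ∞ (coordForm φ β i) φ.target

/-- `L` is a Finsler metric function on `M`: smooth on the slit tangent bundle, positive there,
positively homogeneous of degree one on the fibres, with positive definite metric `g_{ij}`. -/
structure IsFinsler {n : ℕ} {M : Type*} [TopologicalSpace M] [ChartedSpace (Coord n) M]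
    (L : TangentBundle (𝓡 n) M → ℝ) : Prop where
  smooth : ∀ φ ∈ IsManifold.maximalAtlas (𝓡 n) ∞ M,
    ContDiffOn ℝ ∞ (fun z : Coord n × Coord n => coordFun φ L z.1 z.2)
      (φ.target ×ˢ {y : Coord n | y ≠ 0})
  pos : ∀ (p : M) (v : TangentSpace (𝓡 n) p), v ≠ 0 → 0 < L ⟨p, v⟩
  homog : ∀ (p : M) (v : TangentSpace (𝓡 n) p) (t : ℝ), 0 < t → L ⟨p, t • v⟩ = t * L ⟨p, v⟩
  posDef : ∀ φ ∈ IsManifold.maximalAtlas (𝓡 n) ∞ M, ∀ x ∈ φ.target, ∀ y : Coord n, y ≠ 0 →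
    (gMatrix (coordFun φ L) x y).PosDef

end Manifold

end Finsler

end

/-! Differentiating `L' = e^σ L + b_i yⁱ` in `y` gives `L'_i = e^σ L_i + b_i`, `L'_{ij} = e^σ
L_{ij}` and `L'_{ijk} = e^σ L_{ijk}`. The Cartan connection is metrical and `Nⁱ_j = Γⁱ_{jk} yᵏ`;
with Euler's identities this makes `L`, `L_i` and `L_{ij}` horizontally constant (`dDir_hDir_L`,
`dDir_hDir_L1`, `dDir_hDir_L2`). Writing the constancy of `L'_{ij}` and `L'_i` with `Γ' = Γ + D` and
`δ'_k = δ_k - Dʳ_{0k} ∂̇_r`, and subtracting the same facts for `L`, leaves linear equations for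
`D`: `sum_L2_D_add` and `sum_L1_D`.

These equations involve `Dʳ_{0k}` as well, so they are solved from the bottom up: contracted twice
with `y` they determine `Dⁱ_{00}`, contracted once they give `Dⁱ_{0j}` in terms of `Dⁱ_{00}`, and
uncontracted they give `Dⁱ_{jk}` in terms of `Dⁱ_{0j}`. At each level the data are `L_{ir} Vʳ` and
`L'_r Vʳ` for an unknown vector `V`, and `vector_eq` inverts this system once and for all; it
explains the common shape `L g^{ir} u_r + (L/L̄)(w - L b^q u_q) Lⁱ` of all the formulas.

The tensor `C'` is another vector of this kind, because `L'_r C'ʳ_{jk} = 0` and `L' L'_{ir} C'ʳ_{jk}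
= C'_{ijk}`; this gives (a). Parts (b) and (c) are formal consequences of `N' = N + D_0`, `Γ' = Γ +
D` and the symmetry of the connection coefficients in their lower indices. -/

noncomputable section

namespace Finsler

/-! ### Calculus of smooth fields on the slit `(x, y)`-space. -/

section

variable {n : ℕ} {T : Set (Coord n)}

/-- Smoothness of a field at the points of `T` and the nonzero supporting elements. -/
def SmoothFld (T : Set (Coord n)) (f : Fld n) : Prop :=
  ContDiffOn ℝ ∞ (fun z : Coord n × Coord n => f z.1 z.2) (T ×ˢ {y : Coord n | y ≠ 0})

/-- The derivative of a field in the direction `v` of the `(x, y)`-space. -/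
def dDir (v : Coord n × Coord n) (f : Fld n) : Fld n :=
  fun x y => fderiv ℝ (fun z : Coord n × Coord n => f z.1 z.2) (x, y) v

theorem isOpen_slit (hT : IsOpen T) : IsOpen (T ×ˢ {y : Coord n | y ≠ 0}) :=
  hT.prod isOpen_ne

namespace SmoothFld

variable {f f' : Fld n}

theorem contDiffAt (hf : SmoothFld T f) (hT : IsOpen T) {x y : Coord n} (hx : x ∈ T)
    (hy : y ≠ 0) : ContDiffAt ℝ ∞ (fun z : Coord n × Coord n => f z.1 z.2) (x, y) :=
  ContDiffOn.contDiffAt hf ((isOpen_slit hT).mem_nhds ⟨hx, hy⟩)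

theorem differentiableAt (hf : SmoothFld T f) (hT : IsOpen T) {x y : Coord n} (hx : x ∈ T)
    (hy : y ≠ 0) : DifferentiableAt ℝ (fun z : Coord n × Coord n => f z.1 z.2) (x, y) :=
  (hf.contDiffAt hT hx hy).differentiableAt (by simp)

theorem congr (hf : SmoothFld T f) (h : ∀ x ∈ T, ∀ y ≠ 0, f' x y = f x y) : SmoothFld T f' :=
  ContDiffOn.congr hf fun z hz => h z.1 hz.1 z.2 hz.2

theorem add (hf : SmoothFld T f) (hf' : SmoothFld T f') :
    SmoothFld T (fun x y => f x y + f' x y) := ContDiffOn.add hf hf'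

theorem sub (hf : SmoothFld T f) (hf' : SmoothFld T f') :
    SmoothFld T (fun x y => f x y - f' x y) := ContDiffOn.sub hf hf'

theorem mul (hf : SmoothFld T f) (hf' : SmoothFld T f') :
    SmoothFld T (fun x y => f x y * f' x y) := ContDiffOn.mul hf hf'

theorem const (c : ℝ) : SmoothFld T (fun _ _ => c) := contDiffOn_const

theorem inv (hf : SmoothFld T f) (h : ∀ x ∈ T, ∀ y ≠ 0, f x y ≠ 0) :
    SmoothFld T (fun x y => (f x y)⁻¹) :=
  ContDiffOn.inv hf fun z hz => h z.1 hz.1 z.2 hz.2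

theorem sum {ι : Type*} (S : Finset ι) {F : ι → Fld n} (h : ∀ i ∈ S, SmoothFld T (F i)) :
    SmoothFld T (fun x y => ∑ i ∈ S, F i x y) := ContDiffOn.sum h

theorem prod {ι : Type*} (S : Finset ι) {F : ι → Fld n} (h : ∀ i ∈ S, SmoothFld T (F i)) :
    SmoothFld T (fun x y => ∏ i ∈ S, F i x y) := contDiffOn_prod h

theorem coord (i : Fin n) : SmoothFld T (fun _ y => y i) := by
  unfold SmoothFld; fun_prop

theorem of_base {u : Coord n → ℝ} (hu : ContDiffOn ℝ ∞ u T) : SmoothFld T (fun x _ => u x) :=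
  ContDiffOn.comp hu contDiffOn_fst fun _ hz => hz.1

theorem dDir (hf : SmoothFld T f) (hT : IsOpen T) (v : Coord n × Coord n) :
    SmoothFld T (dDir v f) :=
  (ContDiffOn.fderiv_of_isOpen hf (isOpen_slit hT) (by simp)).clm_apply contDiffOn_const

end SmoothFld

section Rules

variable {f f' : Fld n} {x y : Coord n}

theorem dY_eq_dDir (hT : IsOpen T) (hf : SmoothFld T f) (hx : x ∈ T) (hy : y ≠ 0) (i : Fin n) :
    dY i f x y = dDir (0, EuclideanSpace.single i 1) f x y := by
  have h := (hf.differentiableAt hT hx hy).hasFDerivAt.comp y (hasFDerivAt_prodMk_right x y)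
  unfold dY dDir
  rw [show (fun y' => f x y') = (fun z : Coord n × Coord n => f z.1 z.2) ∘ (fun y' => (x, y'))
    from rfl, h.fderiv]
  simp

theorem dX_eq_dDir (hT : IsOpen T) (hf : SmoothFld T f) (hx : x ∈ T) (hy : y ≠ 0) (i : Fin n) :
    dX i f x y = dDir (EuclideanSpace.single i 1, 0) f x y := by
  have h := HasFDerivAt.comp (f := fun x' => (x', y)) x
    (hf.differentiableAt hT hx hy).hasFDerivAt (hasFDerivAt_prodMk_left x y)
  unfold dX dDir
  rw [show (fun x' => f x' y) = (fun z : Coord n × Coord n => f z.1 z.2) ∘ (fun x' => (x', y))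
    from rfl, h.fderiv]
  simp

theorem SmoothFld.dY (hT : IsOpen T) (hf : SmoothFld T f) (i : Fin n) : SmoothFld T (dY i f) :=
  (hf.dDir hT _).congr fun _ hx _ hy => dY_eq_dDir hT hf hx hy i

theorem SmoothFld.dX (hT : IsOpen T) (hf : SmoothFld T f) (i : Fin n) : SmoothFld T (dX i f) :=
  (hf.dDir hT _).congr fun _ hx _ hy => dX_eq_dDir hT hf hx hy i

theorem dDir_congr (hT : IsOpen T) (h : ∀ x ∈ T, ∀ y ≠ 0, f x y = f' x y) (hx : x ∈ T)
    (hy : y ≠ 0) (v : Coord n × Coord n) : dDir v f x y = dDir v f' x y := by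
  unfold dDir
  rw [Filter.EventuallyEq.fderiv_eq]
  filter_upwards [(isOpen_slit hT).mem_nhds (show (x, y) ∈ _ from ⟨hx, hy⟩)] with z hz
  exact h z.1 hz.1 z.2 hz.2

theorem dDir_add (hT : IsOpen T) (hf : SmoothFld T f) (hf' : SmoothFld T f') (hx : x ∈ T)
    (hy : y ≠ 0) (v : Coord n × Coord n) :
    dDir v (fun x y => f x y + f' x y) x y = dDir v f x y + dDir v f' x y := by
  unfold dDir
  rw [fderiv_fun_add (hf.differentiableAt hT hx hy) (hf'.differentiableAt hT hx hy)]
  rfl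

theorem dDir_sub (hT : IsOpen T) (hf : SmoothFld T f) (hf' : SmoothFld T f') (hx : x ∈ T)
    (hy : y ≠ 0) (v : Coord n × Coord n) :
    dDir v (fun x y => f x y - f' x y) x y = dDir v f x y - dDir v f' x y := by
  unfold dDir
  rw [fderiv_fun_sub (hf.differentiableAt hT hx hy) (hf'.differentiableAt hT hx hy)]
  rfl

theorem dDir_mul (hT : IsOpen T) (hf : SmoothFld T f) (hf' : SmoothFld T f') (hx : x ∈ T)
    (hy : y ≠ 0) (v : Coord n × Coord n) :
    dDir v (fun x y => f x y * f' x y) x y = dDir v f x y * f' x y + f x y * dDir v f' x y := by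
  unfold dDir
  rw [fderiv_fun_mul (hf.differentiableAt hT hx hy) (hf'.differentiableAt hT hx hy)]
  simp only [add_apply, smul_apply, smul_eq_mul]
  ring

theorem dDir_sum {ι : Type*} (hT : IsOpen T) (S : Finset ι) {F : ι → Fld n}
    (h : ∀ i ∈ S, SmoothFld T (F i)) (hx : x ∈ T) (hy : y ≠ 0) (v : Coord n × Coord n) :
    dDir v (fun x y => ∑ i ∈ S, F i x y) x y = ∑ i ∈ S, dDir v (F i) x y := by
  unfold dDir
  rw [fderiv_fun_sum fun i hi => (h i hi).differentiableAt hT hx hy]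
  simp

@[simp] theorem dDir_const (v : Coord n × Coord n) (c : ℝ) :
    dDir v (fun _ _ => c) x y = 0 := by
  simp [dDir]

@[simp] theorem dDir_coord (v : Coord n × Coord n) (i : Fin n) :
    dDir v (fun _ y => y i) x y = v.2 i := by
  unfold dDir
  have h : HasFDerivAt (fun z : Coord n × Coord n => z.2 i)
      ((EuclideanSpace.proj i : Coord n →L[ℝ] ℝ).comp (ContinuousLinearMap.snd ℝ _ _)) (x, y) :=
    ((EuclideanSpace.proj i : Coord n →L[ℝ] ℝ).comp
      (ContinuousLinearMap.snd ℝ (Coord n) (Coord n))).hasFDerivAt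
  rw [h.fderiv]
  rfl

theorem dDir_base (hT : IsOpen T) {u : Coord n → ℝ} (hu : ContDiffOn ℝ ∞ u T) (hx : x ∈ T)
    (v : Coord n × Coord n) : dDir v (fun x _ => u x) x y = fderiv ℝ u x v.1 := by
  have hd : DifferentiableAt ℝ u x :=
    (hu.contDiffAt (hT.mem_nhds hx)).differentiableAt (by simp)
  have h := hd.hasFDerivAt.comp (x, y) (hasFDerivAt_fst (𝕜 := ℝ) (p := (x, y)))
  unfold dDir
  rw [show (fun z : Coord n × Coord n => u z.1) = u ∘ Prod.fst from rfl, h.fderiv]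
  simp

/-- Iterated directional derivatives with constant directions are values of the second Fréchet
derivative, which is symmetric for smooth functions. -/
theorem dY_dY_comm (hT : IsOpen T) (hf : SmoothFld T f) (hx : x ∈ T) (hy : y ≠ 0)
    (i j : Fin n) : dY i (dY j f) x y = dY j (dY i f) x y := by
  have key : ∀ v w : Coord n × Coord n, dDir v (dDir w f) x y =
      fderiv ℝ (fderiv ℝ (fun z : Coord n × Coord n => f z.1 z.2)) (x, y) v w := by
    intro v w
    have hd : DifferentiableAt ℝ (fderiv ℝ (fun z : Coord n × Coord n => f z.1 z.2)) (x, y) :=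
      ((hf.contDiffAt hT hx hy).fderiv_right (m := 1) (by norm_cast)).differentiableAt (by simp)
    have := (hd.hasFDerivAt.clm_apply (hasFDerivAt_const w (x, y))).fderiv
    unfold dDir
    rw [this]
    simp
  have hs : IsSymmSndFDerivAt ℝ (fun z : Coord n × Coord n => f z.1 z.2) (x, y) :=
    (hf.contDiffAt hT hx hy).isSymmSndFDerivAt (by simp; exact WithTop.coe_le_coe.2 le_top)
  rw [dY_eq_dDir hT (hf.dY hT j) hx hy, dY_eq_dDir hT (hf.dY hT i) hx hy,
    dDir_congr hT (fun x hx y hy => dY_eq_dDir hT hf hx hy j) hx hy,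
    dDir_congr hT (fun x hx y hy => dY_eq_dDir hT hf hx hy i) hx hy, key, key]
  exact hs.eq _ _

/-- `∂_k` and `∂̇_r` are values of one linear map, the full derivative at `(x, y)`, so `δ_k` is the
derivative in a single direction with `N` frozen at the point. Identities proved for an arbitrary
direction `v` then serve both for `∂̇_k` and for `δ_k`. -/
theorem delta_eq_dDir (L : Fld n) (hT : IsOpen T) (hf : SmoothFld T f) (hx : x ∈ T) (hy : y ≠ 0)
    (k : Fin n) : delta L k f x y =
      dDir (EuclideanSpace.single k 1, -∑ r, N L r k x y • EuclideanSpace.single r 1) f x y := by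
  unfold delta
  rw [dX_eq_dDir hT hf hx hy]
  simp_rw [fun r => dY_eq_dDir hT hf hx hy r]
  unfold dDir
  have h1 : ((EuclideanSpace.single k 1, -∑ r, N L r k x y • EuclideanSpace.single r 1) :
      Coord n × Coord n) = (EuclideanSpace.single k 1, 0) -
        ∑ r, N L r k x y • ((0, EuclideanSpace.single r 1) : Coord n × Coord n) := by
    ext1
    · simp [Prod.fst_sum]
    · simp [Prod.snd_sum]
  rw [h1]
  simp only [map_sub, map_sum, map_smul, smul_eq_mul]

end Rules

end

/-! ### Local Finsler functions: Euler identities, the metric and its inverse. -/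

section

/-- A Finsler function in coordinates, over the open set `T`. -/
structure LocalFinsler {n : ℕ} (T : Set (Coord n)) (L : Fld n) : Prop where
  isOpen : IsOpen T
  smooth : SmoothFld T L
  homog : ∀ x ∈ T, ∀ y ≠ 0, ∀ t : ℝ, 0 < t → L x (t • y) = t * L x y
  posDef : ∀ x ∈ T, ∀ y ≠ 0, (gMatrix L x y).PosDef

variable {n : ℕ} {T : Set (Coord n)} {L f : Fld n} {x y : Coord n}

theorem sum_smul_single (w : Coord n) : ∑ i, w i • EuclideanSpace.single i (1 : ℝ) = w := by
  simpa using (EuclideanSpace.basisFun (Fin n) ℝ).sum_repr w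

theorem sum_dY_mul (f : Fld n) (x y w : Coord n) :
    ∑ i, dY i f x y * w i = fderiv ℝ (fun y' => f x y') y w := by
  conv_rhs => rw [← sum_smul_single w]
  simp only [map_sum, map_smul, smul_eq_mul, dY, mul_comm]

namespace LocalFinsler

theorem smooth_L1 (hL : LocalFinsler T L) (i : Fin n) : SmoothFld T (L1 L i) :=
  hL.smooth.dY hL.isOpen i

theorem smooth_L2 (hL : LocalFinsler T L) (i j : Fin n) : SmoothFld T (L2 L i j) :=
  (hL.smooth_L1 i).dY hL.isOpen j

theorem L1_eq (hL : LocalFinsler T L) (hx : x ∈ T) (hy : y ≠ 0) (i : Fin n) :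
    L1 L i x y = dDir (0, EuclideanSpace.single i 1) L x y :=
  dY_eq_dDir hL.isOpen hL.smooth hx hy i

theorem L2_eq (hL : LocalFinsler T L) (hx : x ∈ T) (hy : y ≠ 0) (i j : Fin n) :
    L2 L i j x y = dDir (0, EuclideanSpace.single j 1) (L1 L i) x y :=
  dY_eq_dDir hL.isOpen (hL.smooth_L1 i) hx hy j

theorem L3_eq (hL : LocalFinsler T L) (hx : x ∈ T) (hy : y ≠ 0) (i j k : Fin n) :
    L3 L i j k x y = dDir (0, EuclideanSpace.single k 1) (L2 L i j) x y :=
  dY_eq_dDir hL.isOpen (hL.smooth_L2 i j) hx hy k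

theorem L2_symm (hL : LocalFinsler T L) (hx : x ∈ T) (hy : y ≠ 0) (i j : Fin n) :
    L2 L i j x y = L2 L j i x y :=
  dY_dY_comm hL.isOpen hL.smooth hx hy j i

theorem L3_symm_left (hL : LocalFinsler T L) (hx : x ∈ T) (hy : y ≠ 0) (i j k : Fin n) :
    L3 L i j k x y = L3 L j i k x y := by
  rw [hL.L3_eq hx hy, hL.L3_eq hx hy]
  exact dDir_congr hL.isOpen (fun x hx y hy => hL.L2_symm hx hy i j) hx hy _

theorem L3_symm_right (hL : LocalFinsler T L) (hx : x ∈ T) (hy : y ≠ 0) (i j k : Fin n) :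
    L3 L i j k x y = L3 L i k j x y :=
  dY_dY_comm hL.isOpen (hL.smooth_L1 i) hx hy k j

/-- Euler's identity `L_i yⁱ = L`. -/
theorem sum_L1_mul (hL : LocalFinsler T L) (hx : x ∈ T) (hy : y ≠ 0) :
    ∑ i, L1 L i x y * y i = L x y := by
  have hd : DifferentiableAt ℝ (fun y' => L x y') y :=
    DifferentiableAt.comp (f := fun y' => (x, y')) y
      (hL.smooth.differentiableAt hL.isOpen hx hy)
      (hasFDerivAt_prodMk_right x y).differentiableAt
  have h1 : HasDerivAt (fun t : ℝ => t • y) y 1 := by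
    simpa using (hasDerivAt_id (1 : ℝ)).smul_const y
  have h2 : HasDerivAt (fun t : ℝ => L x (t • y)) (fderiv ℝ (fun y' => L x y') y y) 1 := by
    refine HasFDerivAt.comp_hasDerivAt (f := fun t : ℝ => t • y) 1 ?_ h1
    simpa using hd.hasFDerivAt
  have h3 : HasDerivAt (fun t : ℝ => L x (t • y)) (L x y) 1 := by
    have h4 : HasDerivAt (fun t : ℝ => t * L x y) (L x y) 1 := by
      simpa using (hasDerivAt_id (1 : ℝ)).mul_const (L x y)
    refine h4.congr_of_eventuallyEq ?_
    -- Homogeneity is available only for `t > 0`, which is enough near `t = 1`, where both sides are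
    -- differentiated.
    filter_upwards [lt_mem_nhds (zero_lt_one (α := ℝ))] with t ht
    exact hL.homog x hx y hy t ht
  rw [← h2.unique h3]
  exact sum_dY_mul L x y y

/-- This is Euler's identity differentiated along `v`; the component `v.2 i` is the derivative of
`yⁱ`. A vertical `v` yields `L_{ij} yʲ = 0`, and a horizontal one enters the proof that `L` is
horizontally constant. -/
theorem sum_dDir_L1_mul (hL : LocalFinsler T L) (hx : x ∈ T) (hy : y ≠ 0)
    (v : Coord n × Coord n) :
    ∑ i, dDir v (L1 L i) x y * y i + ∑ i, L1 L i x y * v.2 i = dDir v L x y := by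
  have hT := hL.isOpen
  rw [← dDir_congr hT (fun x hx y hy => hL.sum_L1_mul hx hy) hx hy v,
    dDir_sum hT _ (fun i _ => (hL.smooth_L1 i).mul (SmoothFld.coord i)) hx hy,
    ← Finset.sum_add_distrib]
  refine Finset.sum_congr rfl fun i _ => ?_
  rw [dDir_mul hT (hL.smooth_L1 i) (SmoothFld.coord i) hx hy, dDir_coord]

/-- `L_{ij} yʲ = 0`. -/
theorem sum_L2_mul (hL : LocalFinsler T L) (hx : x ∈ T) (hy : y ≠ 0) (i : Fin n) :
    ∑ j, L2 L i j x y * y j = 0 := by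
  have h := hL.sum_dDir_L1_mul hx hy (0, EuclideanSpace.single i 1)
  simp only [← hL.L1_eq hx hy, ← hL.L2_eq hx hy, PiLp.single_apply, mul_ite, mul_one, mul_zero,
    Finset.sum_ite_eq', Finset.mem_univ, if_true, add_eq_right] at h
  rw [← h]
  exact Finset.sum_congr rfl fun j _ => by rw [hL.L2_symm hx hy]

theorem sum_L2_mul' (hL : LocalFinsler T L) (hx : x ∈ T) (hy : y ≠ 0) (j : Fin n) :
    ∑ i, L2 L i j x y * y i = 0 := by
  rw [← hL.sum_L2_mul hx hy j]
  exact Finset.sum_congr rfl fun i _ => by rw [hL.L2_symm hx hy]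

theorem sum_dDir_L2_mul (hL : LocalFinsler T L) (hx : x ∈ T) (hy : y ≠ 0)
    (v : Coord n × Coord n) (i : Fin n) :
    ∑ j, dDir v (L2 L i j) x y * y j + ∑ j, L2 L i j x y * v.2 j = 0 := by
  have hT := hL.isOpen
  have h := dDir_congr hT (fun x hx y hy => hL.sum_L2_mul hx hy i) hx hy v
  rw [dDir_const, dDir_sum hT _ (fun j _ => (hL.smooth_L2 i j).mul (SmoothFld.coord j)) hx hy] at h
  rw [← h, ← Finset.sum_add_distrib]
  refine Finset.sum_congr rfl fun j _ => ?_
  rw [dDir_mul hT (hL.smooth_L2 i j) (SmoothFld.coord j) hx hy, dDir_coord]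

/-- `L_{ijk} yʲ = -L_{ik}`. -/
theorem sum_L3_mul (hL : LocalFinsler T L) (hx : x ∈ T) (hy : y ≠ 0) (i k : Fin n) :
    ∑ j, L3 L i j k x y * y j = -L2 L i k x y := by
  have h := hL.sum_dDir_L2_mul hx hy (0, EuclideanSpace.single k 1) i
  simp only [← hL.L3_eq hx hy, PiLp.single_apply, mul_ite, mul_one, mul_zero,
    Finset.sum_ite_eq', Finset.mem_univ, if_true] at h
  linarith

theorem g_eq (hL : LocalFinsler T L) (hx : x ∈ T) (hy : y ≠ 0) (i j : Fin n) :
    g L i j x y = L x y * L2 L i j x y + L1 L i x y * L1 L j x y := by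
  have hT := hL.isOpen
  have h1 : ∀ x ∈ T, ∀ y ≠ 0, dY j (fun x' y' => L x' y' ^ 2) x y
      = 2 * (L x y * L1 L j x y) := by
    intro x hx y hy
    simp only [pow_two]
    rw [dY_eq_dDir hT (hL.smooth.mul hL.smooth) hx hy, dDir_mul hT hL.smooth hL.smooth hx hy,
      ← hL.L1_eq hx hy]
    ring
  have hs := hL.smooth.mul (hL.smooth_L1 j)
  unfold g
  rw [dY_eq_dDir hT ((((SmoothFld.const 2).mul hs).congr h1)) hx hy,
    dDir_congr hT h1 hx hy, dDir_mul hT (SmoothFld.const 2) hs hx hy,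
    dDir_mul hT hL.smooth (hL.smooth_L1 j) hx hy, ← hL.L1_eq hx hy, ← hL.L2_eq hx hy,
    dDir_const, hL.L2_symm hx hy j i]
  ring

theorem smooth_g (hL : LocalFinsler T L) (i j : Fin n) : SmoothFld T (g L i j) :=
  ((hL.smooth.mul (hL.smooth_L2 i j)).add ((hL.smooth_L1 i).mul (hL.smooth_L1 j))).congr
    fun _ hx _ hy => hL.g_eq hx hy i j

theorem dDir_g (hL : LocalFinsler T L) (hx : x ∈ T) (hy : y ≠ 0) (v : Coord n × Coord n)
    (i j : Fin n) : dDir v (g L i j) x y =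
      dDir v L x y * L2 L i j x y + L x y * dDir v (L2 L i j) x y
        + dDir v (L1 L i) x y * L1 L j x y + L1 L i x y * dDir v (L1 L j) x y := by
  have hT := hL.isOpen
  rw [dDir_congr hT (fun x hx y hy => hL.g_eq hx hy i j) hx hy,
    dDir_add hT (hL.smooth.mul (hL.smooth_L2 i j)) ((hL.smooth_L1 i).mul (hL.smooth_L1 j)) hx hy,
    dDir_mul hT hL.smooth (hL.smooth_L2 i j) hx hy,
    dDir_mul hT (hL.smooth_L1 i) (hL.smooth_L1 j) hx hy]
  ring

theorem g_symm (hL : LocalFinsler T L) (hx : x ∈ T) (hy : y ≠ 0) (i j : Fin n) :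
    g L i j x y = g L j i x y := by
  rw [hL.g_eq hx hy, hL.g_eq hx hy, hL.L2_symm hx hy i j]
  ring

/-- `g_{ij} yʲ = L L_i`. -/
theorem sum_g_mul (hL : LocalFinsler T L) (hx : x ∈ T) (hy : y ≠ 0) (i : Fin n) :
    ∑ j, g L i j x y * y j = L x y * L1 L i x y := by
  have h1 := hL.sum_L2_mul hx hy i
  have h2 := hL.sum_L1_mul hx hy
  calc ∑ j, g L i j x y * y j
      = L x y * ∑ j, L2 L i j x y * y j + L1 L i x y * ∑ j, L1 L j x y * y j := by
        rw [Finset.mul_sum, Finset.mul_sum, ← Finset.sum_add_distrib]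
        exact Finset.sum_congr rfl fun j _ => by rw [hL.g_eq hx hy]; ring
    _ = _ := by rw [h1, h2]; ring

/-- Since `g_{ij} yʲ = L L_i`, a zero of `L` would make `y` a null vector of a positive definite
form. -/
theorem ne_zero (hL : LocalFinsler T L) (hx : x ∈ T) (hy : y ≠ 0) : L x y ≠ 0 := by
  intro h0
  have hy' : (fun i => y i) ≠ (0 : Fin n → ℝ) := fun h => hy (by ext i; exact congrFun h i)
  have h := (hL.posDef x hx y hy).dotProduct_mulVec_pos hy'
  have h2 : star (fun i => y i) ⬝ᵥ (gMatrix L x y).mulVec (fun i => y i) = 0 := by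
    simp only [dotProduct, Matrix.mulVec, gMatrix, Matrix.of_apply]
    refine Finset.sum_eq_zero fun i _ => ?_
    rw [hL.sum_g_mul hx hy, h0]
    simp
  exact h.ne' h2

theorem det_ne_zero (hL : LocalFinsler T L) (hx : x ∈ T) (hy : y ≠ 0) :
    (gMatrix L x y).det ≠ 0 := (hL.posDef x hx y hy).det_pos.ne'

theorem gInv_symm (hL : LocalFinsler T L) (hx : x ∈ T) (hy : y ≠ 0) (i j : Fin n) :
    gInv L i j x y = gInv L j i x y := by
  have h := (hL.posDef x hx y hy).inv.isHermitian.apply j i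
  simpa [gInv] using h

/-- `g_{ij} g^{jk} X_k = X_i`. -/
theorem g_mul_gInv (hL : LocalFinsler T L) (hx : x ∈ T) (hy : y ≠ 0) (X : Fin n → ℝ)
    (i : Fin n) : ∑ j, g L i j x y * ∑ k, gInv L j k x y * X k = X i := by
  have h : (gMatrix L x y).mulVec ((gMatrix L x y)⁻¹.mulVec X) = X := by
    rw [Matrix.mulVec_mulVec, Matrix.mul_nonsing_inv _ (hL.det_ne_zero hx hy).isUnit,
      Matrix.one_mulVec]
  exact congrFun h i

/-- `g^{ij} g_{jk} Xᵏ = Xⁱ`. -/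
theorem gInv_mul_g (hL : LocalFinsler T L) (hx : x ∈ T) (hy : y ≠ 0) (X : Fin n → ℝ)
    (i : Fin n) : ∑ j, gInv L i j x y * ∑ k, g L j k x y * X k = X i := by
  have h : (gMatrix L x y)⁻¹.mulVec ((gMatrix L x y).mulVec X) = X := by
    rw [Matrix.mulVec_mulVec, Matrix.nonsing_inv_mul _ (hL.det_ne_zero hx hy).isUnit,
      Matrix.one_mulVec]
  exact congrFun h i

theorem smooth_det (n' : ℕ) {K : Fin n' → Fin n' → Fld n} (h : ∀ i j, SmoothFld T (K i j)) :
    SmoothFld T (fun x y => (Matrix.of fun i j => K i j x y).det) := by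
  simp only [Matrix.det_apply', Matrix.of_apply]
  exact SmoothFld.sum _ fun p _ =>
    (SmoothFld.const _).mul (SmoothFld.prod _ fun i _ => h (p i) i)

/-- By Cramer's rule the inverse is the adjugate over the determinant, and each adjugate entry is
the determinant of a matrix with one row replaced by a constant one. The smoothness of `N` rests on
this. -/
theorem smooth_gInv (hL : LocalFinsler T L) (i j : Fin n) : SmoothFld T (gInv L i j) := by
  have h1 := smooth_det n hL.smooth_g
  have h2 : SmoothFld T (fun x y => (gMatrix L x y).adjugate i j) := by
    have h3 : ∀ p q, SmoothFld T (fun x y =>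
        (gMatrix L x y).updateRow j (Pi.single i 1) p q) := by
      intro p q
      by_cases hp : p = j
      · subst hp
        simp only [Matrix.updateRow_self]
        exact SmoothFld.const _
      · simp only [Matrix.updateRow_ne hp]
        exact hL.smooth_g p q
    simp only [Matrix.adjugate_apply]
    exact smooth_det n h3
  refine ((h1.inv fun x hx y hy => hL.det_ne_zero hx hy).mul h2).congr fun x hx y hy => ?_
  simp [gInv, Matrix.inv_def, gMatrix]

theorem smooth_Clow (hL : LocalFinsler T L) (i j k : Fin n) : SmoothFld T (Clow L i j k) :=
  (SmoothFld.const _).mul ((hL.smooth_g i j).dY hL.isOpen k)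

theorem smooth_C (hL : LocalFinsler T L) (i j k : Fin n) : SmoothFld T (C L i j k) :=
  SmoothFld.sum _ fun _ _ => (hL.smooth_gInv _ _).mul (hL.smooth_Clow _ _ _)

theorem smooth_formalChristoffel (hL : LocalFinsler T L) (i j k : Fin n) :
    SmoothFld T (formalChristoffel L i j k) :=
  (SmoothFld.const _).mul <| SmoothFld.sum _ fun _ _ => (hL.smooth_gInv _ _).mul <|
    (((hL.smooth_g _ _).dX hL.isOpen _).add ((hL.smooth_g _ _).dX hL.isOpen _)).sub
      ((hL.smooth_g _ _).dX hL.isOpen _)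

theorem smooth_N (hL : LocalFinsler T L) (i j : Fin n) : SmoothFld T (N L i j) :=
  (SmoothFld.sum _ fun _ _ => (hL.smooth_formalChristoffel _ _ _).mul (SmoothFld.coord _)).sub <|
    SmoothFld.sum _ fun _ _ => (hL.smooth_C _ _ _).mul <|
      SmoothFld.sum _ fun _ _ => SmoothFld.sum _ fun _ _ =>
        ((hL.smooth_formalChristoffel _ _ _).mul (SmoothFld.coord _)).mul (SmoothFld.coord _)

end LocalFinsler

end

/-! ### The Cartan connection and the horizontal constancy of `L`, `L_i`, `L_{ij}`. -/

section

variable {n : ℕ} {T : Set (Coord n)} {L f : Fld n} {x y : Coord n}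

/-- The horizontal direction `δ_k` at `(x, y)`. -/
def hDir (L : Fld n) (x y : Coord n) (k : Fin n) : Coord n × Coord n :=
  (EuclideanSpace.single k 1, -∑ r, N L r k x y • EuclideanSpace.single r 1)

theorem hDir_snd (L : Fld n) (x y : Coord n) (k i : Fin n) :
    (hDir L x y k).2 i = -N L i k x y := by
  simp [hDir, Finset.sum_apply, Pi.single_apply]

namespace LocalFinsler

theorem delta_eq (hL : LocalFinsler T L) (L' : Fld n) (hf : SmoothFld T f) (hx : x ∈ T)
    (hy : y ≠ 0) (k : Fin n) : delta L' k f x y = dDir (hDir L' x y k) f x y :=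
  delta_eq_dDir L' hL.isOpen hf hx hy k

theorem Clow_eq (hL : LocalFinsler T L) (hx : x ∈ T) (hy : y ≠ 0) (i j k : Fin n) :
    Clow L i j k x y = 1 / 2 * (L1 L k x y * L2 L i j x y + L x y * L3 L i j k x y
      + L2 L i k x y * L1 L j x y + L1 L i x y * L2 L j k x y) := by
  unfold Clow
  rw [dY_eq_dDir hL.isOpen (hL.smooth_g i j) hx hy, hL.dDir_g hx hy, ← hL.L1_eq hx hy,
    ← hL.L2_eq hx hy, ← hL.L2_eq hx hy, ← hL.L3_eq hx hy]

theorem Clow_symm_left (hL : LocalFinsler T L) (hx : x ∈ T) (hy : y ≠ 0) (i j k : Fin n) :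
    Clow L i j k x y = Clow L j i k x y := by
  rw [hL.Clow_eq hx hy, hL.Clow_eq hx hy, hL.L2_symm hx hy i j, hL.L3_symm_left hx hy i j]
  ring

theorem Clow_symm_right (hL : LocalFinsler T L) (hx : x ∈ T) (hy : y ≠ 0) (i j k : Fin n) :
    Clow L i j k x y = Clow L i k j x y := by
  rw [hL.Clow_eq hx hy, hL.Clow_eq hx hy, hL.L2_symm hx hy j k, hL.L3_symm_right hx hy i j]
  ring

theorem sum_Clow_mul_mid (hL : LocalFinsler T L) (hx : x ∈ T) (hy : y ≠ 0) (i k : Fin n) :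
    ∑ j, Clow L i j k x y * y j = 0 := by
  have h1 := hL.sum_L2_mul hx hy i
  have h2 := hL.sum_L1_mul hx hy
  have h3 := hL.sum_L3_mul hx hy i k
  have h4 := hL.sum_L2_mul' hx hy k
  calc ∑ j, Clow L i j k x y * y j
      = 1 / 2 * (L1 L k x y * ∑ j, L2 L i j x y * y j + L x y * ∑ j, L3 L i j k x y * y j
      + L2 L i k x y * ∑ j, L1 L j x y * y j + L1 L i x y * ∑ j, L2 L j k x y * y j) := by
        simp only [Finset.mul_sum, ← Finset.sum_add_distrib]
        exact Finset.sum_congr rfl fun j _ => by rw [hL.Clow_eq hx hy]; ring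
    _ = 0 := by rw [h1, h2, h3, h4]; ring

theorem sum_Clow_mul_left (hL : LocalFinsler T L) (hx : x ∈ T) (hy : y ≠ 0) (j k : Fin n) :
    ∑ i, Clow L i j k x y * y i = 0 := by
  rw [← hL.sum_Clow_mul_mid hx hy j k]
  exact Finset.sum_congr rfl fun i _ => by rw [hL.Clow_symm_left hx hy]

theorem sum_C_mul (hL : LocalFinsler T L) (hx : x ∈ T) (hy : y ≠ 0) (i k : Fin n) :
    ∑ j, C L i j k x y * y j = 0 := by
  simp only [C, Finset.sum_mul]
  rw [Finset.sum_comm]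
  refine Finset.sum_eq_zero fun l _ => ?_
  simp only [mul_assoc]
  rw [← Finset.mul_sum, hL.sum_Clow_mul_mid hx hy, mul_zero]

/-- `Nⁱ_j yʲ = γⁱ_{rs} yʳ yˢ`. -/
theorem sum_N_mul (hL : LocalFinsler T L) (hx : x ∈ T) (hy : y ≠ 0) (i : Fin n) :
    ∑ j, N L i j x y * y j = ∑ r, ∑ s, formalChristoffel L i r s x y * y r * y s := by
  simp only [N, sub_mul, Finset.sum_sub_distrib, Finset.sum_mul]
  rw [sub_eq_iff_eq_add, Finset.sum_comm (f := fun j k => C L i j k x y * _ * y j)]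
  have h : ∀ k, ∑ j, C L i j k x y *
      (∑ r, ∑ s, formalChristoffel L k r s x y * y r * y s) * y j = 0 := by
    intro k
    rw [← mul_zero (∑ r, ∑ s, formalChristoffel L k r s x y * y r * y s),
      ← hL.sum_C_mul hx hy i k, Finset.mul_sum]
    exact Finset.sum_congr rfl fun j _ => by ring
  rw [Finset.sum_eq_zero fun k _ => h k, add_zero]
  exact Finset.sum_congr rfl fun r _ => Finset.sum_congr rfl fun s _ => by ring

theorem delta_g_symm (hL : LocalFinsler T L) (hx : x ∈ T) (hy : y ≠ 0) (i j k : Fin n) :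
    delta L k (g L i j) x y = delta L k (g L j i) x y := by
  rw [hL.delta_eq L (hL.smooth_g i j) hx hy, hL.delta_eq L (hL.smooth_g j i) hx hy]
  exact dDir_congr hL.isOpen (fun x hx y hy => hL.g_symm hx hy i j) hx hy _

theorem Γ_symm (hL : LocalFinsler T L) (hx : x ∈ T) (hy : y ≠ 0) (i j k : Fin n) :
    Γ L i j k x y = Γ L i k j x y := by
  unfold Γ
  congr 1
  refine Finset.sum_congr rfl fun r _ => ?_
  rw [hL.delta_g_symm hx hy r k, hL.delta_g_symm hx hy j r, hL.delta_g_symm hx hy j k]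
  ring

theorem sum_g_mul_Γ (hL : LocalFinsler T L) (hx : x ∈ T) (hy : y ≠ 0) (i j k : Fin n) :
    ∑ r, g L i r x y * Γ L r j k x y = 1 / 2 *
      (delta L j (g L i k) x y + delta L k (g L j i) x y - delta L i (g L j k) x y) := by
  rw [← hL.g_mul_gInv hx hy (fun r =>
    delta L j (g L r k) x y + delta L k (g L j r) x y - delta L r (g L j k) x y) i,
    Finset.mul_sum]
  exact Finset.sum_congr rfl fun r _ => by unfold Γ; ring

/-- The Cartan connection is metrical: `g_{ij|k} = 0`. -/
theorem delta_g (hL : LocalFinsler T L) (hx : x ∈ T) (hy : y ≠ 0) (i j k : Fin n) :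
    delta L k (g L i j) x y =
      ∑ r, g L i r x y * Γ L r j k x y + ∑ r, g L j r x y * Γ L r i k x y := by
  rw [hL.sum_g_mul_Γ hx hy, hL.sum_g_mul_Γ hx hy, hL.delta_g_symm hx hy j i]
  ring

/-- `Nⁱ_j = Γⁱ_{jk} yᵏ`. -/
theorem N_eq (hL : LocalFinsler T L) (hx : x ∈ T) (hy : y ≠ 0) (i j : Fin n) :
    N L i j x y = ∑ k, Γ L i j k x y * y k := by
  set W : Fin n → ℝ := fun k => ∑ r, ∑ s, formalChristoffel L k r s x y * y r * y s with hW
  have hd : ∀ a b c, delta L c (g L a b) x y =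
      dX c (g L a b) x y - ∑ s, N L s c x y * (2 * Clow L a b s x y) := by
    intro a b c
    unfold delta Clow
    congr 1
    exact Finset.sum_congr rfl fun s _ => by ring
  -- Contracted with `yᵏ`, the vertical corrections in `δ_j g_{rk}` and `δ_r g_{jk}` contain
  -- `C_{rks} yᵏ = 0` and `C_{jks} yᵏ = 0`.
  have h1 : ∀ r, ∑ k, delta L j (g L r k) x y * y k = ∑ k, dX j (g L r k) x y * y k := by
    intro r
    simp only [hd, sub_mul, Finset.sum_sub_distrib, Finset.sum_mul]
    rw [sub_eq_self, Finset.sum_comm]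
    refine Finset.sum_eq_zero fun s _ => ?_
    rw [← mul_zero (2 * N L s j x y), ← hL.sum_Clow_mul_mid hx hy r s, Finset.mul_sum]
    exact Finset.sum_congr rfl fun k _ => by ring
  have h2 : ∀ r, ∑ k, delta L r (g L j k) x y * y k = ∑ k, dX r (g L j k) x y * y k := by
    intro r
    simp only [hd, sub_mul, Finset.sum_sub_distrib, Finset.sum_mul]
    rw [sub_eq_self, Finset.sum_comm]
    refine Finset.sum_eq_zero fun s _ => ?_
    rw [← mul_zero (2 * N L s r x y), ← hL.sum_Clow_mul_mid hx hy j s, Finset.mul_sum]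
    exact Finset.sum_congr rfl fun k _ => by ring
  -- Here `yᵏ` meets `N` instead of `g`, and `Nˢ_k yᵏ = γˢ_{00}`; the surviving term is the `C
  -- γ_{00}` correction in the definition of `N`.
  have h3 : ∀ r, ∑ k, delta L k (g L j r) x y * y k = ∑ k, dX k (g L j r) x y * y k
      - 2 * ∑ s, Clow L r j s x y * W s := by
    intro r
    simp only [hd, sub_mul, Finset.sum_sub_distrib, Finset.sum_mul]
    congr 1
    rw [Finset.sum_comm, Finset.mul_sum]
    refine Finset.sum_congr rfl fun s _ => ?_
    rw [hW]
    simp only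
    rw [← hL.sum_N_mul hx hy s, Finset.mul_sum, Finset.mul_sum]
    exact Finset.sum_congr rfl fun k _ => by rw [hL.Clow_symm_left hx hy r j]; ring
  have h4 : ∑ k, Γ L i j k x y * y k = 1 / 2 * ∑ r, gInv L i r x y *
      (∑ k, delta L j (g L r k) x y * y k + ∑ k, delta L k (g L j r) x y * y k
        - ∑ k, delta L r (g L j k) x y * y k) := by
    simp only [Γ, ← Finset.sum_add_distrib, ← Finset.sum_sub_distrib, Finset.mul_sum,
      Finset.sum_mul]
    rw [Finset.sum_comm]
    exact Finset.sum_congr rfl fun r _ => Finset.sum_congr rfl fun k _ => by ring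
  have h5 : ∑ k, formalChristoffel L i j k x y * y k = 1 / 2 * ∑ r, gInv L i r x y *
      (∑ k, dX j (g L r k) x y * y k + ∑ k, dX k (g L j r) x y * y k
        - ∑ k, dX r (g L j k) x y * y k) := by
    simp only [formalChristoffel, ← Finset.sum_add_distrib, ← Finset.sum_sub_distrib,
      Finset.mul_sum, Finset.sum_mul]
    rw [Finset.sum_comm]
    exact Finset.sum_congr rfl fun r _ => Finset.sum_congr rfl fun k _ => by ring
  have h6 : ∑ k, C L i j k x y * W k =
      ∑ r, gInv L i r x y * ∑ s, Clow L r j s x y * W s := by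
    simp only [C, Finset.mul_sum, Finset.sum_mul]
    rw [Finset.sum_comm]
    exact Finset.sum_congr rfl fun r _ => Finset.sum_congr rfl fun k _ => by ring
  rw [h4]
  unfold N
  rw [h5, h6, Finset.mul_sum, Finset.mul_sum, ← Finset.sum_sub_distrib]
  refine Finset.sum_congr rfl fun r _ => ?_
  rw [h1, h2, h3]
  ring

theorem sum_Γ_mul (hL : LocalFinsler T L) (hx : x ∈ T) (hy : y ≠ 0) (r k : Fin n) :
    ∑ j, Γ L r j k x y * y j = N L r k x y := by
  rw [hL.N_eq hx hy]
  exact Finset.sum_congr rfl fun j _ => by rw [hL.Γ_symm hx hy]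

theorem sum_g_mul_mul (hL : LocalFinsler T L) (hx : x ∈ T) (hy : y ≠ 0) (w : Fin n → ℝ) :
    ∑ i, (∑ r, g L i r x y * w r) * y i = L x y * ∑ r, L1 L r x y * w r := by
  simp only [Finset.sum_mul, Finset.mul_sum]
  rw [Finset.sum_comm]
  refine Finset.sum_congr rfl fun r _ => ?_
  rw [← mul_assoc, ← hL.sum_g_mul hx hy r, Finset.sum_mul]
  exact Finset.sum_congr rfl fun j _ => by rw [hL.g_symm hx hy]; ring

theorem sum_g_eq (hL : LocalFinsler T L) (hx : x ∈ T) (hy : y ≠ 0) (w : Fin n → ℝ)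
    (i : Fin n) : ∑ r, g L i r x y * w r =
      L x y * ∑ r, L2 L i r x y * w r + L1 L i x y * ∑ r, L1 L r x y * w r := by
  simp only [Finset.mul_sum, ← Finset.sum_add_distrib]
  exact Finset.sum_congr rfl fun j _ => by rw [hL.g_eq hx hy]; ring

theorem dDir_hDir_g (hL : LocalFinsler T L) (hx : x ∈ T) (hy : y ≠ 0) (i j k : Fin n) :
    dDir (hDir L x y k) (g L i j) x y =
      ∑ r, g L i r x y * Γ L r j k x y + ∑ r, g L j r x y * Γ L r i k x y := by
  rw [← hL.delta_eq L (hL.smooth_g i j) hx hy, hL.delta_g hx hy]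

theorem sum_dDir_hDir_g_mul (hL : LocalFinsler T L) (hx : x ∈ T) (hy : y ≠ 0) (i k : Fin n) :
    ∑ j, dDir (hDir L x y k) (g L i j) x y * y j = ∑ r, g L i r x y * N L r k x y
        + L x y * ∑ r, L1 L r x y * Γ L r i k x y := by
  have hr : ∑ j, (∑ r, g L i r x y * Γ L r j k x y) * y j = ∑ r, g L i r x y * N L r k x y := by
    simp only [Finset.sum_mul]
    rw [Finset.sum_comm]
    refine Finset.sum_congr rfl fun r _ => ?_
    rw [← hL.sum_Γ_mul hx hy r, Finset.mul_sum]
    exact Finset.sum_congr rfl fun j _ => by ring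
  rw [← hL.sum_g_mul_mul hx hy, ← hr, ← Finset.sum_add_distrib]
  exact Finset.sum_congr rfl fun j _ => by rw [hL.dDir_hDir_g hx hy]; ring

/-- Obtained from `g_{ij} = L L_{ij} + L_i L_j` and the differentiated Euler identities. Comparing
with `sum_dDir_hDir_g_mul`, where the same contraction is computed from metricity, isolates the
horizontal derivatives of `L` and `L_i`. -/
theorem sum_dDir_g_mul (hL : LocalFinsler T L) (hx : x ∈ T) (hy : y ≠ 0)
    (v : Coord n × Coord n) (i : Fin n) :
    ∑ j, dDir v (g L i j) x y * y j = - L x y * ∑ j, L2 L i j x y * v.2 j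
      + dDir v (L1 L i) x y * L x y + L1 L i x y * (dDir v L x y - ∑ j, L1 L j x y * v.2 j) := by
  have h1 : ∑ j, dDir v (g L i j) x y * y j = dDir v L x y * ∑ j, L2 L i j x y * y j
      + L x y * ∑ j, dDir v (L2 L i j) x y * y j
      + dDir v (L1 L i) x y * ∑ j, L1 L j x y * y j
      + L1 L i x y * ∑ j, dDir v (L1 L j) x y * y j := by
    simp only [Finset.mul_sum, ← Finset.sum_add_distrib]
    exact Finset.sum_congr rfl fun j _ => by rw [hL.dDir_g hx hy]; ring
  rw [h1, hL.sum_L2_mul hx hy, hL.sum_L1_mul hx hy,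
    eq_neg_of_add_eq_zero_left (hL.sum_dDir_L2_mul hx hy v i),
    eq_sub_of_add_eq (hL.sum_dDir_L1_mul hx hy v)]
  ring

/-- `L_{|k} = 0`. -/
theorem dDir_hDir_L (hL : LocalFinsler T L) (hx : x ∈ T) (hy : y ≠ 0) (k : Fin n) :
    dDir (hDir L x y k) L x y = 0 := by
  set v := hDir L x y k with hv
  -- Both contractions of `δ_k g_{ij}` with `yⁱ yʲ` are computed: metricity gives `2L L_r Nʳ_k`,
  -- while the Euler identities give `2L (δ_k L + L_r Nʳ_k)`.
  have hR : ∑ i, (∑ j, dDir v (g L i j) x y * y j) * y i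
      = 2 * (L x y * ∑ r, L1 L r x y * N L r k x y) := by
    simp only [hv, hL.sum_dDir_hDir_g_mul hx hy, add_mul, Finset.sum_add_distrib]
    rw [hL.sum_g_mul_mul hx hy, two_mul]
    congr 1
    simp only [Finset.mul_sum, Finset.sum_mul]
    rw [Finset.sum_comm]
    refine Finset.sum_congr rfl fun r _ => ?_
    rw [← hL.sum_Γ_mul hx hy r, Finset.mul_sum, Finset.mul_sum]
    exact Finset.sum_congr rfl fun j _ => by ring
  have h1 : ∑ i, (∑ j, dDir v (g L i j) x y * y j) * y i =
      - L x y * ∑ i, (∑ j, L2 L i j x y * v.2 j) * y i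
      + L x y * ∑ i, dDir v (L1 L i) x y * y i
      + (dDir v L x y - ∑ j, L1 L j x y * v.2 j) * ∑ i, L1 L i x y * y i := by
    rw [Finset.mul_sum, Finset.mul_sum, Finset.mul_sum _ _ (dDir v L x y - _),
      ← Finset.sum_add_distrib, ← Finset.sum_add_distrib]
    exact Finset.sum_congr rfl fun i _ => by rw [hL.sum_dDir_g_mul hx hy]; ring
  have h2 : ∑ i, (∑ j, L2 L i j x y * v.2 j) * y i = 0 := by
    simp only [Finset.sum_mul]
    rw [Finset.sum_comm]
    refine Finset.sum_eq_zero fun j _ => ?_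
    rw [← mul_zero (v.2 j), ← hL.sum_L2_mul' hx hy j, Finset.mul_sum]
    exact Finset.sum_congr rfl fun i _ => by ring
  have h0 : ∑ j, L1 L j x y * v.2 j = -∑ r, L1 L r x y * N L r k x y := by
    simp [hv, hDir_snd]
  rw [h2, hL.sum_L1_mul hx hy, eq_sub_of_add_eq (hL.sum_dDir_L1_mul hx hy v), hR, h0] at h1
  have : 2 * L x y * dDir v L x y = 0 := by linarith
  simpa [hL.ne_zero hx hy] using this

/-- `L_{i|k} = 0`. -/
theorem dDir_hDir_L1 (hL : LocalFinsler T L) (hx : x ∈ T) (hy : y ≠ 0) (i k : Fin n) :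
    dDir (hDir L x y k) (L1 L i) x y = ∑ r, L1 L r x y * Γ L r i k x y := by
  have h1 := hL.sum_dDir_hDir_g_mul hx hy i k
  rw [hL.sum_dDir_g_mul hx hy, hL.dDir_hDir_L hx hy, hL.sum_g_eq hx hy] at h1
  simp only [hDir_snd, mul_neg, Finset.sum_neg_distrib] at h1
  refine mul_left_cancel₀ (hL.ne_zero hx hy) ?_
  linarith

/-- `L_{ij|k} = 0`. -/
theorem dDir_hDir_L2 (hL : LocalFinsler T L) (hx : x ∈ T) (hy : y ≠ 0) (i j k : Fin n) :
    dDir (hDir L x y k) (L2 L i j) x y =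
      ∑ r, L2 L i r x y * Γ L r j k x y + ∑ r, L2 L j r x y * Γ L r i k x y := by
  have h1 := hL.dDir_hDir_g hx hy i j k
  rw [hL.dDir_g hx hy, hL.dDir_hDir_L hx hy, hL.dDir_hDir_L1 hx hy, hL.dDir_hDir_L1 hx hy,
    hL.sum_g_eq hx hy, hL.sum_g_eq hx hy] at h1
  refine mul_left_cancel₀ (hL.ne_zero hx hy) ?_
  linarith

theorem sum_gInv_L1 (hL : LocalFinsler T L) (hx : x ∈ T) (hy : y ≠ 0) (i : Fin n) :
    ∑ r, gInv L i r x y * L1 L r x y = Lup L i x y := by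
  have h := hL.gInv_mul_g hx hy (fun k => y k) i
  simp only [hL.sum_g_mul hx hy] at h
  rw [Lup, eq_div_iff (hL.ne_zero hx hy), ← h, Finset.sum_mul]
  exact Finset.sum_congr rfl fun r _ => by ring

end LocalFinsler

end

/-! ### The `β`-conformal change and the linear equations for the difference tensor. -/

section

/-- A `β`-conformal change of Finsler functions, in coordinates over the open set `T`. -/
structure BetaChange {n : ℕ} (T : Set (Coord n)) (L L' : Fld n) (s : Coord n → ℝ)
    (b : Fin n → Coord n → ℝ) : Prop where
  left : LocalFinsler T L
  right : LocalFinsler T L'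
  smooth_s : ContDiffOn ℝ ∞ s T
  smooth_b : ∀ i, ContDiffOn ℝ ∞ (b i) T
  eq : ∀ x ∈ T, ∀ y ≠ 0, L' x y = Lbar L s b x y

variable {n : ℕ} {T : Set (Coord n)} {L L' f : Fld n} {s : Coord n → ℝ}
  {b : Fin n → Coord n → ℝ} {x y : Coord n}

namespace BetaChange

theorem smooth_exp (h : BetaChange T L L' s b) :
    ContDiffOn ℝ ∞ (fun x => Real.exp (s x)) T := h.smooth_s.exp

theorem dDir_exp (h : BetaChange T L L' s b) (hx : x ∈ T) (v : Coord n × Coord n) :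
    dDir v (fun x _ => Real.exp (s x)) x y = Real.exp (s x) * fderiv ℝ s x v.1 := by
  have hd : DifferentiableAt ℝ s x :=
    (h.smooth_s.contDiffAt (h.left.isOpen.mem_nhds hx)).differentiableAt (by simp)
  rw [dDir_base h.left.isOpen h.smooth_exp hx, fderiv_exp hd]
  rfl

theorem L1_eq (h : BetaChange T L L' s b) (hx : x ∈ T) (hy : y ≠ 0) (i : Fin n) :
    L1 L' i x y = Real.exp (s x) * L1 L i x y + b i x := by
  have hT := h.left.isOpen
  have he := SmoothFld.of_base h.smooth_exp
  have hb := fun j => (SmoothFld.of_base (h.smooth_b j)).mul (SmoothFld.coord (T := T) j)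
  rw [h.right.L1_eq hx hy, dDir_congr hT h.eq hx hy]
  unfold Lbar
  rw [dDir_add hT (he.mul h.left.smooth) (SmoothFld.sum _ fun j _ => hb j) hx hy,
    dDir_mul hT he h.left.smooth hx hy, dDir_sum hT _ (fun j _ => hb j) hx hy, h.dDir_exp hx,
    ← h.left.L1_eq hx hy]
  have : ∀ j, dDir (0, EuclideanSpace.single i 1) (fun x y => b j x * y j) x y =
      if j = i then b j x else 0 := by
    intro j
    rw [dDir_mul hT (SmoothFld.of_base (h.smooth_b j)) (SmoothFld.coord j) hx hy,
      dDir_base hT (h.smooth_b j) hx]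
    simp
  simp [this]

theorem dDir_L1 (h : BetaChange T L L' s b) (hx : x ∈ T) (hy : y ≠ 0)
    (v : Coord n × Coord n) (i : Fin n) :
    dDir v (L1 L' i) x y = Real.exp (s x) *
      (fderiv ℝ s x v.1 * L1 L i x y + dDir v (L1 L i) x y) + fderiv ℝ (b i) x v.1 := by
  have hT := h.left.isOpen
  have he := SmoothFld.of_base h.smooth_exp
  rw [dDir_congr hT (fun x hx y hy => h.L1_eq hx hy i) hx hy,
    dDir_add hT (he.mul (h.left.smooth_L1 i)) (SmoothFld.of_base (h.smooth_b i)) hx hy,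
    dDir_mul hT he (h.left.smooth_L1 i) hx hy, h.dDir_exp hx, dDir_base hT (h.smooth_b i) hx]
  ring

theorem L2_eq (h : BetaChange T L L' s b) (hx : x ∈ T) (hy : y ≠ 0) (i j : Fin n) :
    L2 L' i j x y = Real.exp (s x) * L2 L i j x y := by
  rw [h.right.L2_eq hx hy, h.dDir_L1 hx hy, h.left.L2_eq hx hy]
  simp

theorem dDir_L2 (h : BetaChange T L L' s b) (hx : x ∈ T) (hy : y ≠ 0)
    (v : Coord n × Coord n) (i j : Fin n) :
    dDir v (L2 L' i j) x y = Real.exp (s x) *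
      (fderiv ℝ s x v.1 * L2 L i j x y + dDir v (L2 L i j) x y) := by
  have hT := h.left.isOpen
  have he := SmoothFld.of_base h.smooth_exp
  rw [dDir_congr hT (fun x hx y hy => h.L2_eq hx hy i j) hx hy,
    dDir_mul hT he (h.left.smooth_L2 i j) hx hy, h.dDir_exp hx]
  ring

theorem L3_eq (h : BetaChange T L L' s b) (hx : x ∈ T) (hy : y ≠ 0) (i j k : Fin n) :
    L3 L' i j k x y = Real.exp (s x) * L3 L i j k x y := by
  rw [h.right.L3_eq hx hy, h.dDir_L2 hx hy, h.left.L3_eq hx hy]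
  simp

theorem D_symm (h : BetaChange T L L' s b) (hx : x ∈ T) (hy : y ≠ 0) (i j k : Fin n) :
    D L L' i j k x y = D L L' i k j x y := by
  unfold D
  rw [h.left.Γ_symm hx hy, h.right.Γ_symm hx hy]

/-- For both functions the nonlinear connection is the `y`-contraction of `Γ`. Hence `Dⁱ_{0j}` is
smooth and governs the change of `δ_k`. -/
theorem D0_eq (h : BetaChange T L L' s b) (hx : x ∈ T) (hy : y ≠ 0) (i j : Fin n) :
    D0 L L' i j x y = N L' i j x y - N L i j x y := by
  rw [← h.left.sum_Γ_mul hx hy, ← h.right.sum_Γ_mul hx hy, ← Finset.sum_sub_distrib]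
  exact Finset.sum_congr rfl fun r _ => by unfold D; ring

theorem delta_right (h : BetaChange T L L' s b) (hx : x ∈ T) (hy : y ≠ 0) (f : Fld n)
    (k : Fin n) : delta L' k f x y =
      delta L k f x y - ∑ r, D0 L L' r k x y * dY r f x y := by
  unfold delta
  rw [sub_sub, ← Finset.sum_add_distrib]
  congr 1
  exact Finset.sum_congr rfl fun r _ => by rw [h.D0_eq hx hy]; ring

/-- Horizontal constancy of `L'_{ij}`, in terms of `L`. -/
theorem sum_L2_D_add (h : BetaChange T L L' s b) (hx : x ∈ T) (hy : y ≠ 0) (i j k : Fin n) :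
    ∑ r, L2 L i r x y * D L L' r j k x y + ∑ r, L2 L j r x y * D L L' r i k x y =
      sd s k x * L2 L i j x y - ∑ r, L3 L i j r x y * D0 L L' r k x y := by
  -- Start from `L'_{ij|k} = 0` for the connection of `L'` and expand it by that of `L`. The terms
  -- of `L_{ij|k} = 0` cancel, `δ_k e^σ` contributes `σ_k`, and the factor `e^σ` drops out.
  have h1 := h.right.dDir_hDir_L2 hx hy i j k
  rw [← h.right.delta_eq L' (h.right.smooth_L2 i j) hx hy, h.delta_right hx hy,
    h.right.delta_eq L (h.right.smooth_L2 i j) hx hy, h.dDir_L2 hx hy,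
    h.left.dDir_hDir_L2 hx hy] at h1
  have h2 : ∑ r, D0 L L' r k x y * dY r (L2 L' i j) x y =
      Real.exp (s x) * ∑ r, L3 L i j r x y * D0 L L' r k x y := by
    rw [Finset.mul_sum]
    refine Finset.sum_congr rfl fun r _ => ?_
    change _ * L3 L' i j r x y = _
    rw [h.L3_eq hx hy]
    ring
  have h3 : ∀ i j, ∑ r, L2 L' i r x y * Γ L' r j k x y = Real.exp (s x) *
      (∑ r, L2 L i r x y * D L L' r j k x y + ∑ r, L2 L i r x y * Γ L r j k x y) := by
    intro i j
    rw [← Finset.sum_add_distrib, Finset.mul_sum]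
    exact Finset.sum_congr rfl fun r _ => by rw [h.L2_eq hx hy]; unfold D; ring
  rw [h2, h3, h3] at h1
  refine mul_left_cancel₀ (Real.exp_ne_zero (s x)) ?_
  simp only [sd, hDir] at h1 ⊢
  linarith

/-- Horizontal constancy of `L'_i`, in terms of `L`. -/
theorem sum_L1_D (h : BetaChange T L L' s b) (hx : x ∈ T) (hy : y ≠ 0) (i k : Fin n) :
    ∑ r, L1 L' r x y * D L L' r i k x y = bCov L b i k x y +
      Real.exp (s x) * (sd s k x * L1 L i x y - ∑ r, L2 L i r x y * D0 L L' r k x y) := by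
  have h1 := h.right.dDir_hDir_L1 hx hy i k
  rw [← h.right.delta_eq L' (h.right.smooth_L1 i) hx hy, h.delta_right hx hy,
    h.right.delta_eq L (h.right.smooth_L1 i) hx hy, h.dDir_L1 hx hy,
    h.left.dDir_hDir_L1 hx hy] at h1
  have h2 : ∑ r, D0 L L' r k x y * dY r (L1 L' i) x y =
      Real.exp (s x) * ∑ r, L2 L i r x y * D0 L L' r k x y := by
    rw [Finset.mul_sum]
    refine Finset.sum_congr rfl fun r _ => ?_
    change _ * L2 L' i r x y = _
    rw [h.L2_eq hx hy]
    ring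
  have h3 : ∑ r, L1 L' r x y * Γ L' r i k x y = ∑ r, L1 L' r x y * D L L' r i k x y +
      (Real.exp (s x) * ∑ r, L1 L r x y * Γ L r i k x y + ∑ r, b r x * Γ L r i k x y) := by
    rw [Finset.mul_sum, ← Finset.sum_add_distrib, ← Finset.sum_add_distrib]
    exact Finset.sum_congr rfl fun r _ => by rw [h.L1_eq hx hy]; unfold D; ring
  rw [h2, h3] at h1
  simp only [bCov, sd, hDir] at h1 ⊢
  linarith

/-- `bᵠ L_q = β / L`. -/
theorem sum_bUp_L1 (h : BetaChange T L L' s b) (hx : x ∈ T) (hy : y ≠ 0) :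
    ∑ q, bUp L b q x y * L1 L q x y = (∑ q, b q x * y q) / L x y := by
  have h1 : ∑ q, bUp L b q x y * L1 L q x y = ∑ q, b q x * Lup L q x y := by
    simp only [bUp, ← h.left.sum_gInv_L1 hx hy, Finset.sum_mul, Finset.mul_sum]
    rw [Finset.sum_comm]
    exact Finset.sum_congr rfl fun q _ => Finset.sum_congr rfl fun r _ => by
      rw [h.left.gInv_symm hx hy]; ring
  rw [h1, Finset.sum_div]
  exact Finset.sum_congr rfl fun q _ => by unfold Lup; ring

theorem sum_bUp (h : BetaChange T L L' s b) (hx : x ∈ T) (hy : y ≠ 0) (w : Fin n → ℝ) :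
    ∑ q, bUp L b q x y * w q = ∑ q, b q x * ∑ r, gInv L q r x y * w r := by
  simp only [bUp, Finset.sum_mul, Finset.mul_sum]
  rw [Finset.sum_comm]
  exact Finset.sum_congr rfl fun q _ => Finset.sum_congr rfl fun r _ => by
    rw [h.left.gInv_symm hx hy]; ring

/-- A vector is determined by its contractions with `L_{ij}` and with `L'_i`. -/
theorem vector_eq (h : BetaChange T L L' s b) (hx : x ∈ T) (hy : y ≠ 0) (V u : Fin n → ℝ)
    (hu : ∀ r, ∑ q, L2 L r q x y * V q = u r) (w : ℝ) (hw : ∑ r, L1 L' r x y * V r = w)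
    (i : Fin n) :
    V i = L x y * ∑ r, gInv L i r x y * u r + L x y / Lbar L s b x y *
      (w - L x y * ∑ q, bUp L b q x y * u q) * Lup L i x y := by
  have hL0 := h.left.ne_zero hx hy
  have hL0' := h.right.ne_zero hx hy
  set c := ∑ r, L1 L r x y * V r with hc
  -- Lowering gives `g_{ij} Vʲ = L u_i + c L_i`; raising again turns `L_i` into `Lⁱ`, so only the
  -- scalar `c` remains unknown.
  have hV : ∀ i, V i = L x y * ∑ r, gInv L i r x y * u r + Lup L i x y * c := by
    intro i
    rw [← h.left.gInv_mul_g hx hy V i, ← h.left.sum_gInv_L1 hx hy, Finset.mul_sum,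
      Finset.sum_mul, ← Finset.sum_add_distrib]
    exact Finset.sum_congr rfl fun r _ => by rw [h.left.sum_g_eq hx hy, hu]; ring
  have hb : ∑ q, b q x * V q = L x y * ∑ q, bUp L b q x y * u q
      + c * ((∑ q, b q x * y q) / L x y) := by
    rw [h.sum_bUp hx hy, Finset.sum_div, Finset.mul_sum, Finset.mul_sum,
      ← Finset.sum_add_distrib]
    exact Finset.sum_congr rfl fun q _ => by rw [hV q]; unfold Lup; ring
  have hw' : w = Real.exp (s x) * c + ∑ q, b q x * V q := by
    rw [← hw, hc, Finset.mul_sum, ← Finset.sum_add_distrib]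
    exact Finset.sum_congr rfl fun q _ => by rw [h.L1_eq hx hy]; ring
  -- In `w = e^σ c + b_q V^q` the total coefficient of `c` is `e^σ + β/L = L̄/L`, which is nonzero.
  have hcw : c = L x y / Lbar L s b x y * (w - L x y * ∑ q, bUp L b q x y * u q) := by
    rw [← h.eq x hx y hy, hw', hb]
    field_simp
    rw [h.eq x hx y hy]
    unfold Lbar
    ring
  rw [← hcw, hV i]
  ring

end BetaChange

end

/-! ### Solving for `Dⁱ_{00}`, `Dⁱ_{0j}` and `Dⁱ_{jk}`. -/

section

variable {n : ℕ} {T : Set (Coord n)} {L L' f : Fld n} {s : Coord n → ℝ}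
  {b : Fin n → Coord n → ℝ} {x y : Coord n}

/-- `Dⁱ_{00} = Dⁱ_{0j} yʲ`. -/
def D00 (L L' : Fld n) (i : Fin n) : Fld n := fun x y => ∑ j, D0 L L' i j x y * y j

namespace BetaChange

theorem sum_mul_D_left (c : Fin n → ℝ) (k : Fin n) :
    ∑ j, (∑ r, c r * D L L' r j k x y) * y j = ∑ r, c r * D0 L L' r k x y := by
  simp only [D0, Finset.sum_mul, Finset.mul_sum]
  rw [Finset.sum_comm]
  exact Finset.sum_congr rfl fun r _ => Finset.sum_congr rfl fun j _ => by ring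

theorem sum_mul_D_right (h : BetaChange T L L' s b) (hx : x ∈ T) (hy : y ≠ 0) (c : Fin n → ℝ)
    (j : Fin n) : ∑ k, (∑ r, c r * D L L' r j k x y) * y k = ∑ r, c r * D0 L L' r j x y := by
  simp only [h.D_symm hx hy _ j]
  exact sum_mul_D_left c j

theorem sum_mul_D0 (c : Fin n → ℝ) :
    ∑ j, (∑ r, c r * D0 L L' r j x y) * y j = ∑ r, c r * D00 L L' r x y := by
  simp only [D00, Finset.sum_mul, Finset.mul_sum]
  rw [Finset.sum_comm]
  exact Finset.sum_congr rfl fun r _ => Finset.sum_congr rfl fun j _ => by ring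

theorem exp_mul_exp_neg (a : ℝ) : Real.exp a * Real.exp (-a) = 1 := by
  rw [← Real.exp_add, add_neg_cancel, Real.exp_zero]

/-- `L_{ir} Dʳ_{0j}`. -/
theorem sum_L2_D0 (h : BetaChange T L L' s b) (hx : x ∈ T) (hy : y ≠ 0) (i j : Fin n) :
    ∑ r, L2 L i r x y * D0 L L' r j x y =
      Real.exp (-s x) * F L b i j x y - 1 / 2 * ∑ r, L3 L i j r x y * D00 L L' r x y
      + 1 / 2 * (sd0 s x y * L2 L i j x y - (sd s i x * L1 L j x y - sd s j x * L1 L i x y)) := by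
  -- The part symmetric in `i, j` is the equation for `L'_{ij}` contracted with `yᵏ`.
  have hsym : ∑ r, L2 L i r x y * D0 L L' r j x y + ∑ r, L2 L j r x y * D0 L L' r i x y =
      sd0 s x y * L2 L i j x y - ∑ r, L3 L i j r x y * D00 L L' r x y := by
    rw [← h.sum_mul_D_right hx hy, ← h.sum_mul_D_right hx hy, ← sum_mul_D0,
      ← Finset.sum_add_distrib, sd0, Finset.sum_mul, ← Finset.sum_sub_distrib]
    refine Finset.sum_congr rfl fun k _ => ?_
    rw [← add_mul, h.sum_L2_D_add hx hy]
    ring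
  have h1 := h.sum_L1_D hx hy i j
  have h2 := h.sum_L1_D hx hy j i
  simp only [h.D_symm hx hy _ j i] at h2
  have he := exp_mul_exp_neg (s x)
  -- The skew part comes from the equation for `L'_i`: its left side `L'_r Dʳ_{ij}` is symmetric, so
  -- exchanging `i` and `j` and subtracting eliminates it and leaves `F_{ij}`.
  have hskew : ∑ r, L2 L i r x y * D0 L L' r j x y - ∑ r, L2 L j r x y * D0 L L' r i x y =
      2 * Real.exp (-s x) * F L b i j x y + sd s j x * L1 L i x y - sd s i x * L1 L j x y := by
    refine mul_left_cancel₀ (Real.exp_ne_zero (s x)) ?_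
    unfold F
    linear_combination h1 - h2 + (bCov L b j i x y - bCov L b i j x y) * he
  linear_combination (hsym + hskew) / 2

/-- `L'_r Dʳ_{0j}`. -/
theorem sum_L1_D0 (h : BetaChange T L L' s b) (hx : x ∈ T) (hy : y ≠ 0) (j : Fin n) :
    ∑ r, L1 L' r x y * D0 L L' r j x y =
      E0 L b j x y - 1 / 2 * Real.exp (s x) * ∑ r, L2 L j r x y * D00 L L' r x y
      + 1 / 2 * Real.exp (s x) * (sd0 s x y * L1 L j x y + sd s j x * L x y) := by
  -- By symmetry of `D`, the contraction can be taken in either lower slot. The two evaluations `h1`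
  -- and `h2` involve `b_{i|j} yⁱ` and `b_{j|i} yⁱ`, and their mean produces `E_{0j}` and the
  -- factors `1/2`.
  have h1 : ∑ r, L1 L' r x y * D0 L L' r j x y = ∑ i, bCov L b i j x y * y i
      + Real.exp (s x) * (sd s j x * L x y) := by
    have h0 : ∑ i, (∑ r, L2 L i r x y * D0 L L' r j x y) * y i = 0 := by
      simp only [Finset.sum_mul]
      rw [Finset.sum_comm]
      refine Finset.sum_eq_zero fun r _ => ?_
      rw [← mul_zero (D0 L L' r j x y), ← h.left.sum_L2_mul' hx hy r, Finset.mul_sum]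
      exact Finset.sum_congr rfl fun i _ => by ring
    have : ∑ i, (∑ r, L1 L' r x y * D L L' r i j x y) * y i = ∑ i, bCov L b i j x y * y i +
        Real.exp (s x) * (sd s j x * ∑ i, L1 L i x y * y i
          - ∑ i, (∑ r, L2 L i r x y * D0 L L' r j x y) * y i) := by
      rw [Finset.mul_sum, ← Finset.sum_sub_distrib, Finset.mul_sum, ← Finset.sum_add_distrib]
      exact Finset.sum_congr rfl fun i _ => by rw [h.sum_L1_D hx hy]; ring
    rw [← sum_mul_D_left, this, h0, h.left.sum_L1_mul hx hy]
    ring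
  have h2 : ∑ r, L1 L' r x y * D0 L L' r j x y = ∑ i, bCov L b j i x y * y i
      + Real.exp (s x) * (sd0 s x y * L1 L j x y - ∑ r, L2 L j r x y * D00 L L' r x y) := by
    rw [← h.sum_mul_D_right hx hy, ← sum_mul_D0, sd0, Finset.sum_mul, ← Finset.sum_sub_distrib,
      Finset.mul_sum, ← Finset.sum_add_distrib]
    exact Finset.sum_congr rfl fun i _ => by rw [h.sum_L1_D hx hy]; ring
  have h3 : E0 L b j x y =
      1 / 2 * (∑ i, bCov L b i j x y * y i + ∑ i, bCov L b j i x y * y i) := by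
    rw [E0, ← Finset.sum_add_distrib, Finset.mul_sum]
    exact Finset.sum_congr rfl fun i _ => by unfold E; ring
  rw [h3]
  linear_combination (h1 + h2) / 2

/-- `L_{ir} Dʳ_{00}`. -/
theorem sum_L2_D00 (h : BetaChange T L L' s b) (hx : x ∈ T) (hy : y ≠ 0) (i : Fin n) :
    ∑ r, L2 L i r x y * D00 L L' r x y =
      2 * Real.exp (-s x) * F0 L b i x y - L x y * sd s i x + sd0 s x y * L1 L i x y := by
  -- Since `L_{ijr} yʲ = -L_{ir}`, the unknown `L_{ir} Dʳ_{00}` reappears on the right with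
  -- coefficient `1/2`; solving for it doubles the remaining terms.
  have h3 : ∑ j, (∑ r, L3 L i j r x y * D00 L L' r x y) * y j =
      -∑ r, L2 L i r x y * D00 L L' r x y := by
    simp only [Finset.sum_mul]
    rw [Finset.sum_comm, ← Finset.sum_neg_distrib]
    refine Finset.sum_congr rfl fun r _ => ?_
    rw [← neg_mul, ← h.left.sum_L3_mul hx hy i r, Finset.sum_mul]
    exact Finset.sum_congr rfl fun j _ => by ring
  have h4 : ∑ j, (∑ r, L2 L i r x y * D0 L L' r j x y) * y j =
      Real.exp (-s x) * F0 L b i x y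
        - 1 / 2 * ∑ j, (∑ r, L3 L i j r x y * D00 L L' r x y) * y j
        + 1 / 2 * (sd0 s x y * ∑ j, L2 L i j x y * y j
          - (sd s i x * ∑ j, L1 L j x y * y j - (∑ j, sd s j x * y j) * L1 L i x y)) := by
    rw [F0, Finset.sum_mul]
    simp only [Finset.mul_sum (Finset.univ : Finset (Fin n)), ← Finset.sum_sub_distrib,
      ← Finset.sum_add_distrib]
    refine Finset.sum_congr rfl fun j _ => ?_
    rw [h.sum_L2_D0 hx hy]
    ring
  rw [sum_mul_D0, h3, h.left.sum_L2_mul hx hy, h.left.sum_L1_mul hx hy, ← sd0] at h4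
  linarith

/-- `L'_r Dʳ_{00}`. -/
theorem sum_L1_D00 (h : BetaChange T L L' s b) (hx : x ∈ T) (hy : y ≠ 0) :
    ∑ r, L1 L' r x y * D00 L L' r x y =
      E00 L b x y + Real.exp (s x) * (sd0 s x y * L x y) := by
  have h3 : ∑ j, (∑ r, L2 L j r x y * D00 L L' r x y) * y j = 0 := by
    simp only [Finset.sum_mul]
    rw [Finset.sum_comm]
    refine Finset.sum_eq_zero fun r _ => ?_
    rw [← mul_zero (D00 L L' r x y), ← h.left.sum_L2_mul' hx hy r, Finset.mul_sum]
    exact Finset.sum_congr rfl fun i _ => by ring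
  have h4 : ∑ j, (∑ r, L1 L' r x y * D0 L L' r j x y) * y j = E00 L b x y
      - 1 / 2 * Real.exp (s x) * ∑ j, (∑ r, L2 L j r x y * D00 L L' r x y) * y j
      + 1 / 2 * Real.exp (s x) * (sd0 s x y * ∑ j, L1 L j x y * y j
        + (∑ j, sd s j x * y j) * L x y) := by
    rw [E00, Finset.sum_mul]
    simp only [Finset.mul_sum (Finset.univ : Finset (Fin n)), ← Finset.sum_sub_distrib,
      ← Finset.sum_add_distrib]
    refine Finset.sum_congr rfl fun j _ => ?_
    rw [h.sum_L1_D0 hx hy]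
    ring
  rw [sum_mul_D0, h3, h.left.sum_L1_mul hx hy, ← sd0] at h4
  linarith

theorem D00_eq (h : BetaChange T L L' s b) (hx : x ∈ T) (hy : y ≠ 0) (i : Fin n) :
    D00 L L' i x y = D00Expl L s b i x y := by
  have hL0 := h.left.ne_zero hx hy
  have hL0' : Lbar L s b x y ≠ 0 := by
    rw [← h.eq x hx y hy]; exact h.right.ne_zero hx hy
  have hu : ∑ r, gInv L i r x y *
      (2 * Real.exp (-s x) * F0 L b r x y - L x y * sd s r x + sd0 s x y * L1 L r x y) =
      2 * Real.exp (-s x) * F0Up L b i x y - L x y * sUp L s i x y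
        + sd0 s x y * Lup L i x y := by
    simp only [F0Up, sUp, ← h.left.sum_gInv_L1 hx hy, Finset.mul_sum, ← Finset.sum_sub_distrib,
      ← Finset.sum_add_distrib]
    exact Finset.sum_congr rfl fun r _ => by rw [h.left.gInv_symm hx hy r i]; ring
  have hb : ∑ q, bUp L b q x y *
      (2 * Real.exp (-s x) * F0 L b q x y - L x y * sd s q x + sd0 s x y * L1 L q x y) =
      2 * Real.exp (-s x) * Fβ0 L b x y - L x y * sβ L s b x y
        + sd0 s x y * ((∑ q, b q x * y q) / L x y) := by
    rw [← h.sum_bUp_L1 hx hy]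
    simp only [Fβ0, sβ, Finset.mul_sum, ← Finset.sum_sub_distrib, ← Finset.sum_add_distrib]
    exact Finset.sum_congr rfl fun r _ => by ring
  rw [h.vector_eq hx hy (fun i => D00 L L' i x y) _ (fun r => h.sum_L2_D00 hx hy r) _
    (h.sum_L1_D00 hx hy) i, hu, hb]
  -- With `β = L̄ - e^σ L`, the two terms `σ_0 L Lⁱ` cancel, and the `e^σ` contributions add up to
  -- `2L e^σ σ_0`.
  have hB : ∑ q, b q x * y q = Lbar L s b x y - Real.exp (s x) * L x y := by unfold Lbar; ring
  rw [hB]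
  unfold D00Expl
  field_simp
  ring

theorem D0_eq_D0Expl (h : BetaChange T L L' s b) (hx : x ∈ T) (hy : y ≠ 0) (i j : Fin n) :
    D0 L L' i j x y = D0Expl L s b i j x y := by
  refine h.vector_eq hx hy (fun i => D0 L L' i j x y) (fun r => G2 L s b r j x y) (fun r => ?_)
    (G1 L s b j x y) ?_ i
  · rw [h.sum_L2_D0 hx hy]
    simp only [h.D00_eq hx hy, G2]
  · rw [h.sum_L1_D0 hx hy]
    simp only [h.D00_eq hx hy, G1]

theorem D_eq_DExpl (h : BetaChange T L L' s b) (hx : x ∈ T) (hy : y ≠ 0) (i j k : Fin n) :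
    D L L' i j k x y = DExpl L s b i j k x y := by
  refine h.vector_eq hx hy (fun i => D L L' i j k x y) (fun r => H3 L s b r j k x y)
    (fun r => ?_) (H2 L s b j k x y) ?_ i
  -- The Christoffel trick: in `h1 + h2 - h3` the symmetry of `D` leaves only `2 L_{rq} D^q_{jk}` on
  -- the left.
  · have h1 := h.sum_L2_D_add hx hy r j k
    have h2 := h.sum_L2_D_add hx hy r k j
    have h3 := h.sum_L2_D_add hx hy j k r
    simp only [h.D_symm hx hy _ k j] at h2
    simp only [h.D_symm hx hy _ k r, h.D_symm hx hy _ j r] at h3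
    simp only [H3, ← h.D0_eq_D0Expl hx hy]
    linarith
  -- Averaging over the exchange of `j` and `k` turns `b_{j|k}` into `E_{jk}`.
  · have h1 := h.sum_L1_D hx hy j k
    have h2 := h.sum_L1_D hx hy k j
    simp only [h.D_symm hx hy _ k j] at h2
    simp only [H2, E, ← h.D0_eq_D0Expl hx hy]
    linarith

/-! ### The torsion tensor `C`. -/

theorem sum_bUp_h (h : BetaChange T L L' s b) (hx : x ∈ T) (hy : y ≠ 0) (j : Fin n) :
    ∑ q, bUp L b q x y * Finsler.h L q j x y = m L b j x y := by
  have h1 : ∑ q, bUp L b q x y * g L q j x y = b j x := by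
    rw [← h.left.g_mul_gInv hx hy (fun q => b q x) j]
    exact Finset.sum_congr rfl fun q _ => by rw [h.left.g_symm hx hy]; unfold bUp; ring
  have h2 : ∑ q, bUp L b q x y * Finsler.h L q j x y =
      ∑ q, bUp L b q x y * g L q j x y - (∑ q, bUp L b q x y * L1 L q x y) * L1 L j x y := by
    rw [Finset.sum_mul, ← Finset.sum_sub_distrib]
    exact Finset.sum_congr rfl fun q _ => by rw [h.left.g_eq hx hy]; unfold Finsler.h; ring
  rw [h2, h1, h.sum_bUp_L1 hx hy, m]

/-- The vectors `bⁱ` and `mⁱ` differ by a multiple of `Lⁱ`, and `m_i Lⁱ = 0` by Euler's identity. -/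
theorem sum_bUp_m (h : BetaChange T L L' s b) (hx : x ∈ T) (hy : y ≠ 0) :
    ∑ q, bUp L b q x y * m L b q x y = mSq L b x y := by
  have hL0 := h.left.ne_zero hx hy
  have h1 : ∀ i, mUp L b i x y = bUp L b i x y - (∑ j, b j x * y j) / L x y * Lup L i x y := by
    intro i
    rw [mUp, bUp, ← h.left.sum_gInv_L1 hx hy, Finset.mul_sum, ← Finset.sum_sub_distrib]
    exact Finset.sum_congr rfl fun r _ => by unfold m; ring
  have h2 : ∑ i, m L b i x y * Lup L i x y = 0 := by
    obtain ⟨B, hB⟩ : ∃ B, B = ∑ j, b j x * y j := ⟨_, rfl⟩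
    have hm : ∀ i, m L b i x y = b i x - B / L x y * L1 L i x y := fun i => by rw [hB]; rfl
    have : ∑ i, m L b i x y * Lup L i x y = (∑ i, b i x * y i) / L x y -
        B / L x y * ((∑ i, L1 L i x y * y i) / L x y) := by
      rw [Finset.sum_div, Finset.sum_div, Finset.mul_sum, ← Finset.sum_sub_distrib]
      exact Finset.sum_congr rfl fun r _ => by rw [hm]; unfold Lup; ring
    rw [this, h.left.sum_L1_mul hx hy, div_self hL0, hB]
    ring
  have h3 : mSq L b x y = ∑ q, bUp L b q x y * m L b q x y
      - (∑ j, b j x * y j) / L x y * ∑ i, m L b i x y * Lup L i x y := by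
    rw [mSq, Finset.mul_sum, ← Finset.sum_sub_distrib]
    exact Finset.sum_congr rfl fun r _ => by rw [h1]; ring
  rw [h3, h2]
  ring

theorem Clow_right (h : BetaChange T L L' s b) (hx : x ∈ T) (hy : y ≠ 0) (i j k : Fin n) :
    Clow L' i j k x y = Real.exp (s x) * (L' x y / L x y) * (Clow L i j k x y
      + 1 / (2 * L' x y) * (Finsler.h L i j x y * m L b k x y
        + Finsler.h L i k x y * m L b j x y + Finsler.h L j k x y * m L b i x y)) := by
  have hL0 := h.left.ne_zero hx hy
  have hL0' := h.right.ne_zero hx hy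
  have hB : ∑ q, b q x * y q = L' x y - Real.exp (s x) * L x y := by
    rw [h.eq x hx y hy]; unfold Lbar; ring
  rw [h.right.Clow_eq hx hy, h.left.Clow_eq hx hy]
  simp only [h.L1_eq hx hy, h.L2_eq hx hy, h.L3_eq hx hy, m, Finsler.h, hB]
  field_simp
  ring

theorem C_eq (h : BetaChange T L L' s b) (hx : x ∈ T) (hy : y ≠ 0) (i j k : Fin n) :
    C L' i j k x y = C L i j k x y + A L s b i j k x y := by
  have hL0 := h.left.ne_zero hx hy
  have hL0' := h.right.ne_zero hx hy
  have hg : ∀ r, ∑ q, g L' r q x y * C L' q j k x y = Clow L' r j k x y := fun r =>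
    h.right.g_mul_gInv hx hy (fun l => Clow L' l j k x y) r
  -- Contracting `g'_{qr} C'ʳ_{jk} = C'_{qjk}` with `y^q` gives `L' L'_r C'ʳ_{jk} = 0`. Hence the
  -- `L'_i L'_j` part of `g'` does not contribute in `hu`, and `vector_eq` applies with `w = 0`.
  have hw : ∑ r, L1 L' r x y * C L' r j k x y = 0 := by
    have := h.right.sum_g_mul_mul hx hy (fun q => C L' q j k x y)
    simp only [hg, h.right.sum_Clow_mul_left hx hy] at this
    simpa [hL0'] using this.symm
  have hu : ∀ r, ∑ q, L2 L r q x y * C L' q j k x y = 1 / L x y * (Clow L r j k x y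
      + 1 / (2 * L' x y) * (Finsler.h L r j x y * m L b k x y
        + Finsler.h L r k x y * m L b j x y + Finsler.h L j k x y * m L b r x y)) := by
    intro r
    have h1 := h.right.sum_g_eq hx hy (fun q => C L' q j k x y) r
    rw [hg, hw, h.Clow_right hx hy] at h1
    simp only [h.L2_eq hx hy, mul_assoc, ← Finset.mul_sum] at h1
    have he := Real.exp_ne_zero (s x)
    refine mul_left_cancel₀ (mul_ne_zero hL0' he) ?_
    rw [mul_zero, add_zero] at h1
    rw [mul_assoc, ← h1]
    ring
  have h1 : ∑ r, gInv L i r x y * (1 / L x y * (Clow L r j k x y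
      + 1 / (2 * L' x y) * (Finsler.h L r j x y * m L b k x y
        + Finsler.h L r k x y * m L b j x y + Finsler.h L j k x y * m L b r x y))) =
      1 / L x y * (C L i j k x y + 1 / (2 * L' x y) * (hUp L i j x y * m L b k x y
        + hUp L i k x y * m L b j x y + Finsler.h L j k x y * mUp L b i x y)) := by
    simp only [C, hUp, mUp, Finset.mul_sum, Finset.sum_mul, ← Finset.sum_add_distrib]
    exact Finset.sum_congr rfl fun r _ => by ring
  have h2 : ∑ r, bUp L b r x y * (1 / L x y * (Clow L r j k x y
      + 1 / (2 * L' x y) * (Finsler.h L r j x y * m L b k x y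
        + Finsler.h L r k x y * m L b j x y + Finsler.h L j k x y * m L b r x y))) =
      1 / L x y * (∑ q, Clow L j k q x y * bUp L b q x y + 1 / (2 * L' x y) *
        (2 * m L b j x y * m L b k x y + mSq L b x y * Finsler.h L j k x y)) := by
    have : 2 * m L b j x y * m L b k x y + mSq L b x y * Finsler.h L j k x y =
        (∑ q, bUp L b q x y * Finsler.h L q j x y) * m L b k x y
        + (∑ q, bUp L b q x y * Finsler.h L q k x y) * m L b j x y
        + (∑ q, bUp L b q x y * m L b q x y) * Finsler.h L j k x y := by
      rw [h.sum_bUp_h hx hy, h.sum_bUp_h hx hy, h.sum_bUp_m hx hy]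
      ring
    rw [this]
    simp only [Finset.mul_sum, Finset.sum_mul, ← Finset.sum_add_distrib]
    exact Finset.sum_congr rfl fun r _ => by
      rw [h.left.Clow_symm_left hx hy r j, h.left.Clow_symm_right hx hy j r]; ring
  rw [h.vector_eq hx hy (fun i => C L' i j k x y) _ hu 0 hw i, h1, h2, A, τ,
    ← h.eq x hx y hy]
  have he := Real.exp_ne_zero (s x)
  field_simp
  ring

/-! ### The torsion tensors `P` and `R`. -/

theorem B_eq (h : BetaChange T L L' s b) (hx : x ∈ T) (hy : y ≠ 0) (i j k : Fin n) :
    B L L' i j k x y = dY k (N L' i j) x y - dY k (N L i j) x y := by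
  have hT := h.left.isOpen
  have hs := (h.right.smooth_N i j).sub (h.left.smooth_N i j)
  have h0 : ∀ x ∈ T, ∀ y ≠ 0, D0 L L' i j x y = N L' i j x y - N L i j x y :=
    fun x hx y hy => h.D0_eq hx hy i j
  unfold B
  rw [dY_eq_dDir hT (hs.congr h0) hx hy, dDir_congr hT h0 hx hy,
    dDir_sub hT (h.right.smooth_N i j) (h.left.smooth_N i j) hx hy,
    ← dY_eq_dDir hT (h.right.smooth_N i j) hx hy, ← dY_eq_dDir hT (h.left.smooth_N i j) hx hy]

theorem P_eq (h : BetaChange T L L' s b) (hx : x ∈ T) (hy : y ≠ 0) (i j k : Fin n) :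
    P L' i j k x y = P L i j k x y - D L L' i j k x y + B L L' i j k x y := by
  rw [h.B_eq hx hy]
  unfold P D
  ring

/-- `δ_k N'ⁱ_j`, up to terms symmetric in `j` and `k`. -/
theorem delta_N_right (h : BetaChange T L L' s b) (hx : x ∈ T) (hy : y ≠ 0) (i j k : Fin n) :
    delta L' k (N L' i j) x y = delta L k (N L i j) x y + (hCov L (D0 L L') i j k x y
      - ∑ r, (B L L' i j r x y + P L i j r x y) * D0 L L' r k x y)
      - ∑ r, Γ L i r j x y * D0 L L' r k x y - ∑ r, Γ L i r k x y * D0 L L' r j x y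
      + ∑ r, D0 L L' i r x y * Γ L r j k x y := by
  have hT := h.left.isOpen
  have h0 : ∀ x ∈ T, ∀ y ≠ 0, D0 L L' i j x y = N L' i j x y - N L i j x y :=
    fun x hx y hy => h.D0_eq hx hy i j
  have hN := h.left.smooth_N i j
  have hN' := h.right.smooth_N i j
  have h1 : delta L k (D0 L L' i j) x y = delta L k (N L' i j) x y - delta L k (N L i j) x y := by
    rw [h.left.delta_eq L ((hN'.sub hN).congr h0) hx hy, dDir_congr hT h0 hx hy,
      dDir_sub hT hN' hN hx hy, h.left.delta_eq L hN' hx hy, h.left.delta_eq L hN hx hy]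
  -- `B + P` equals `∂̇_r N'ⁱ_j - Γⁱ_{jr}`, so this sum contains exactly the vertical correction in
  -- `δ'_k N'ⁱ_j`.
  have h2 : ∑ r, (B L L' i j r x y + P L i j r x y) * D0 L L' r k x y =
      ∑ r, D0 L L' r k x y * dY r (N L' i j) x y - ∑ r, Γ L i r j x y * D0 L L' r k x y := by
    rw [← Finset.sum_sub_distrib]
    refine Finset.sum_congr rfl fun r _ => ?_
    rw [h.B_eq hx hy, P, h.left.Γ_symm hx hy i j r]
    ring
  have h3 : ∑ r, D0 L L' r j x y * Γ L i r k x y = ∑ r, Γ L i r k x y * D0 L L' r j x y :=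
    Finset.sum_congr rfl fun r _ => mul_comm _ _
  rw [h.delta_right hx hy, hCov, h1, h2, h3]
  ring

/-- The extra terms in `delta_N_right` are symmetric in `j` and `k`: two of them are exchanged, and
the last is symmetric because `Γʳ_{jk}` is. They vanish under antisymmetrisation. -/
theorem R_eq (h : BetaChange T L L' s b) (hx : x ∈ T) (hy : y ≠ 0) (i j k : Fin n) :
    R L' i j k x y = R L i j k x y +
      ((hCov L (D0 L L') i j k x y -
          ∑ r, (B L L' i j r x y + P L i j r x y) * D0 L L' r k x y) -
        (hCov L (D0 L L') i k j x y -
          ∑ r, (B L L' i k r x y + P L i k r x y) * D0 L L' r j x y)) := by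
  unfold R
  rw [h.delta_N_right hx hy i j k, h.delta_N_right hx hy i k j]
  simp only [h.left.Γ_symm hx hy _ k j]
  ring

end BetaChange

/-! ### From the manifold to a chart. -/

theorem IsFinsler.localFinsler {M : Type*} [TopologicalSpace M] [ChartedSpace (Coord n) M]
    {l : TangentBundle (𝓡 n) M → ℝ} (hl : IsFinsler l)
    {φ : OpenPartialHomeomorph M (Coord n)} (hφ : φ ∈ IsManifold.maximalAtlas (𝓡 n) ∞ M) :
    LocalFinsler φ.target (coordFun φ l) where
  isOpen := φ.open_target
  smooth := hl.smooth φ hφ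
  homog x _ y _ t ht := by
    unfold coordFun
    rw [← hl.homog _ _ t ht]
    congr 2
    exact (mfderiv (𝓡 n) (𝓡 n) φ.symm x).map_smul t y
  posDef := hl.posDef φ hφ

theorem coordForm_sum {M : Type*} [TopologicalSpace M] [ChartedSpace (Coord n) M]
    (φ : OpenPartialHomeomorph M (Coord n)) (β : ∀ p : M, TangentSpace (𝓡 n) p →L[ℝ] ℝ)
    (x y : Coord n) : ∑ i, coordForm φ β i x * y i =
      β (φ.symm x) (mfderiv (𝓡 n) (𝓡 n) φ.symm x y) := by
  let c : Coord n →L[ℝ] ℝ := (β (φ.symm x)).comp (mfderiv (𝓡 n) (𝓡 n) φ.symm x)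
  change ∑ i, c (EuclideanSpace.single i 1) * y i = c y
  conv_rhs => rw [← sum_smul_single y]
  simp only [map_sum, map_smul, smul_eq_mul, mul_comm]

theorem betaChange_coord {M : Type*} [TopologicalSpace M] [ChartedSpace (Coord n) M]
    [IsManifold (𝓡 n) ∞ M] {l l' : TangentBundle (𝓡 n) M → ℝ} (hl : IsFinsler l)
    (hl' : IsFinsler l') {σ : M → ℝ} (hσ : ContMDiff (𝓡 n) 𝓘(ℝ, ℝ) ∞ σ)
    {β : ∀ p : M, TangentSpace (𝓡 n) p →L[ℝ] ℝ} (hβ : IsSmoothForm β)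
    (hchange : ∀ (p : M) (v : TangentSpace (𝓡 n) p),
      l' ⟨p, v⟩ = Real.exp (σ p) * l ⟨p, v⟩ + β p v)
    {φ : OpenPartialHomeomorph M (Coord n)} (hφ : φ ∈ IsManifold.maximalAtlas (𝓡 n) ∞ M) :
    BetaChange φ.target (coordFun φ l) (coordFun φ l') (fun x => σ (φ.symm x))
      (coordForm φ β) where
  left := hl.localFinsler hφ
  right := hl'.localFinsler hφ
  smooth_s := by
    rw [← contMDiffOn_iff_contDiffOn]
    exact hσ.comp_contMDiffOn (contMDiffOn_symm_of_mem_maximalAtlas hφ)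
  smooth_b := hβ φ hφ
  eq x _ y _ := by
    rw [Lbar, coordForm_sum]
    exact hchange _ _

end

end Finsler

end

theorem proposition4p4 {n : ℕ} {M : Type*} [TopologicalSpace M]
    [ChartedSpace (Finsler.Coord n) M] [IsManifold (𝓡 n) ∞ M]
    (L L' : TangentBundle (𝓡 n) M → ℝ) (hL : Finsler.IsFinsler L) (hL' : Finsler.IsFinsler L')
    (σ : M → ℝ) (hσ : ContMDiff (𝓡 n) 𝓘(ℝ, ℝ) ∞ σ)
    (β : ∀ p : M, TangentSpace (𝓡 n) p →L[ℝ] ℝ) (hβ : Finsler.IsSmoothForm β)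
    (hchange : ∀ (p : M) (v : TangentSpace (𝓡 n) p),
      L' ⟨p, v⟩ = Real.exp (σ p) * L ⟨p, v⟩ + β p v)
    (φ : OpenPartialHomeomorph M (Finsler.Coord n))
    (hφ : φ ∈ IsManifold.maximalAtlas (𝓡 n) ∞ M)
    (x : Finsler.Coord n) (hx : x ∈ φ.target) (y : Finsler.Coord n) (hy : y ≠ 0) :
    let l : Finsler.Fld n := Finsler.coordFun φ L
    let l' : Finsler.Fld n := Finsler.coordFun φ L'
    let s : Finsler.Coord n → ℝ := fun x' => σ (φ.symm x')
    let b : Fin n → Finsler.Coord n → ℝ := Finsler.coordForm φ β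
    -- the difference tensor and its contraction have the explicit expressions
    (∀ i j k : Fin n, Finsler.D l l' i j k x y = Finsler.DExpl l s b i j k x y) ∧
    (∀ i j : Fin n, Finsler.D0 l l' i j x y = Finsler.D0Expl l s b i j x y) ∧
    -- (a)
    (∀ i j k : Fin n, Finsler.C l' i j k x y = Finsler.C l i j k x y + Finsler.A l s b i j k x y) ∧
    -- (b)
    (∀ i j k : Fin n, Finsler.P l' i j k x y =
      Finsler.P l i j k x y - Finsler.D l l' i j k x y + Finsler.B l l' i j k x y) ∧
    -- (c)
    (∀ i j k : Fin n, Finsler.R l' i j k x y = Finsler.R l i j k x y +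
      ((Finsler.hCov l (Finsler.D0 l l') i j k x y -
          ∑ r, (Finsler.B l l' i j r x y + Finsler.P l i j r x y) * Finsler.D0 l l' r k x y) -
        (Finsler.hCov l (Finsler.D0 l l') i k j x y -
          ∑ r, (Finsler.B l l' i k r x y + Finsler.P l i k r x y) * Finsler.D0 l l' r j x y))) := by
  have h := Finsler.betaChange_coord hL hL' hσ hβ hchange hφ
  exact ⟨h.D_eq_DExpl hx hy, h.D0_eq_D0Expl hx hy, h.C_eq hx hy, h.P_eq hx hy, h.R_eq hx hy⟩
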